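/- Theorem (Mass gap). For $n\ge 3$ let $C_n$ be the circular simplicial complex with vertices $\{a\}$ and edges $\{a,a+1\}$, $a\in\mathbb Z/n$, and let $\mathbb Z$ also denote the infinite complex with vertices $\{a\}$ and edges $\{a,a+1\}$, $a\in\mathbb Z$. For a one-dimensional complex $K$ and an integer $d\ge 1$, the cells of $K^d$ are the products $x_1\times\cdots\times x_d$ of faces of $K$, and the connection Laplacian is $L(K^d)=1+A$, where $A$ is the adjacency matrix of the graph in which two different cells are joined if they intersect. For finite $K$ the density of states $dk(K^d)$ is the normalized counting measure on the eigenvalues of $L(K^d)$, with multiplicity. The $m$-th Barycentric refinement of $K$ is denoted $K_m$. Let $d\ge 1$. Then: 1. For every $n\ge 3$ the connection spectrum is multiplicative: $dk(C_n^d)$ is the image of the product measure $dk(C_n)\otimes\cdots\otimes dk(C_n)$ under $(\lambda_1,\dots,\lambda_d)\mapsto\lambda_1\cdots\lambda_d$; and $L(C_n^d)$ has no eigenvalue in $[-1/5^d,1/5^d]$. 2. There is a probability measure $dk$ on $\mathbb R$ such that $dk(C_n^d)\to dk$ weakly as $n\to\infty$, and, for every fixed $n\ge 3$, $dk\big(((C_n)_m)^d\big)\to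 dk$ weakly as $m\to\infty$ (Barycentric limit, refining each factor). The measure $dk$ is absolutely continuous, and its support is disjoint from $[-1/5^d,1/5^d]$. 3. Label the faces of $\mathbb Z$ and of $C_n$ by $2a\mapsto\{a\}$, $2a+1\mapsto\{a,a+1\}$ (for $C_n$ modulo $n$), and so the cells of $\mathbb Z^d$ and $C_n^d$ by $j\in\mathbb Z^d$. There is a bounded self-adjoint operator $L$ on $\ell^2(\mathbb Z^d)$ whose matrix entries are those of the connection Laplacian of the lattice $\mathbb Z^d$, and which is the entrywise limit of $L(C_n^d)$ as $n\to\infty$ and also, for every fixed $n\ge 3$ and suitable cyclic labellings by $\mathbb Z$ of the faces of the refinements $(C_n)_m$, the entrywise limit of $L\big(((C_n)_m)^d\big)$ as $m\to\infty$. The operator $L$ is almost periodic over the compact group $\mathbb D_2^d=\mathbb Z_2^d$ of dyadic integers: there is a norm continuous family $(L_x)_{x\in\mathbb D_2^d}$ of bounded operators on $\ell^2(\mathbb Z^d)$ with $L_0=L$ and $\langle e_i,L_{x+m}e_j\rangle=\langle e_{i+m},L_xe_{j+m}\rangle$ for all $x\in\mathbb D_2^d$ and $m,i,j\in\mathbb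 Z^d$. Moreover $L$ has a bounded inverse, and $[-1/5^d,1/5^d]$ does not meet its spectrum. -/

import Mathlib

open scoped ENNReal

noncomputable section

/-- The one-dimensional complex of nearest neighbours over `R`: its faces are the vertices `{a}` and
the edges `{a, a + 1}`. For `R = ZMod n` with `n ≥ 3` it is the circular complex `C_n` (with `n`
vertices and `n` edges), and for `R = ℤ` it is the line, the one-dimensional lattice. -/
def nearestNeighborComplex (R : Type) [AddGroupWithOne R] : PreAbstractSimplicialComplex R where
  faces := {s | ∃ a : R, (s : Set R) = {a} ∨ (s : Set R) = {a, a + 1}}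
  isRelLowerSet_faces := by
    rintro s ⟨a, h⟩
    have hs : s.Nonempty := by
      rw [← Finset.coe_nonempty]
      rcases h with h | h <;> rw [h]
      · exact Set.singleton_nonempty a
      · exact Set.insert_nonempty _ _
    refine ⟨hs, ?_⟩
    intro t hts ht
    have hts' : (t : Set R) ⊆ {a, a + 1} := by
      intro x hx
      have hx' : x ∈ (s : Set R) := hts hx
      rcases h with h | h <;> rw [h] at hx' <;> simp_all
    have ht' : (t : Set R) ≠ ∅ := by
      rw [← Set.nonempty_iff_ne_empty]
      exact ht
    rcases Set.subset_pair_iff_eq.1 hts' with h1 | h1 | h1 | h1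
    · exact absurd h1 ht'
    · exact ⟨a, Or.inl h1⟩
    · exact ⟨a + 1, Or.inl h1⟩
    · exact ⟨a, Or.inr h1⟩

/-- The circular complex `C_n` (used for `n ≥ 3`). -/
abbrev circularComplex (n : ℕ) : PreAbstractSimplicialComplex (ZMod n) :=
  nearestNeighborComplex (ZMod n)

/-- The line: the one-dimensional lattice `ℤ` as an infinite simplicial complex. -/
abbrev lineComplex : PreAbstractSimplicialComplex ℤ := nearestNeighborComplex ℤ

/-! ### Products and connection Laplacians -/

/-- The cells `x₁ × ⋯ × x_d` of the Cartesian power `K^d`, given by their factors, which are faces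
of `K`. -/
def Cell {V : Type} (K : PreAbstractSimplicialComplex V) (d : ℕ) : Type := Fin d → K.faces

instance {V : Type} [Finite V] (K : PreAbstractSimplicialComplex V) (d : ℕ) :
    Fintype (Cell K d) :=
  haveI : Finite (Cell K d) := inferInstanceAs (Finite (Fin d → K.faces))
  Fintype.ofFinite _

instance {V : Type} (K : PreAbstractSimplicialComplex V) (d : ℕ) : DecidableEq (Cell K d) :=
  Classical.decEq _

/-- The set `x₁ × ⋯ × x_d` of points of the cell `x`. -/
def Cell.toSet {V : Type} {K : PreAbstractSimplicialComplex V} {d : ℕ} (x : Cell K d) :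
    Set (Fin d → V) :=
  {p | ∀ i, p i ∈ (x i : Finset V)}

/-- The connection graph of `K^d`: two different cells are adjacent if they intersect. -/
def connectionGraph {V : Type} (K : PreAbstractSimplicialComplex V) (d : ℕ) :
    SimpleGraph (Cell K d) where
  Adj x y := x ≠ y ∧ (x.toSet ∩ y.toSet).Nonempty
  symm := ⟨fun x y h => ⟨h.1.symm, by rw [Set.inter_comm]; exact h.2⟩⟩
  loopless := ⟨fun _ h => h.1 rfl⟩

open Classical in
/-- The connection Laplacian `L = 1 + A` of `K^d`, where `A` is the adjacency matrix of the
connection graph. -/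
def connectionLaplacian {V : Type} (K : PreAbstractSimplicialComplex V) (d : ℕ) :
    Matrix (Cell K d) (Cell K d) ℝ :=
  1 + (connectionGraph K d).adjMatrix ℝ

theorem connectionLaplacian_isHermitian {V : Type} (K : PreAbstractSimplicialComplex V) (d : ℕ) :
    (connectionLaplacian K d).IsHermitian := by
  classical
  unfold connectionLaplacian
  refine Matrix.IsHermitian.add Matrix.isHermitian_one ?_
  ext x y
  simp [SimpleGraph.adj_comm]

/-- The density of states of the connection Laplacian of `K^d`, for a finite complex `K`: the
normalized counting measure on its eigenvalues, counted with multiplicity. -/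
def densityOfStates {V : Type} [Finite V] (K : PreAbstractSimplicialComplex V) (d : ℕ) :
    MeasureTheory.Measure ℝ :=
  (Fintype.card (Cell K d) : ℝ≥0∞)⁻¹ •
    ∑ x : Cell K d,
      MeasureTheory.Measure.dirac ((connectionLaplacian_isHermitian K d).eigenvalues x)

/-! ### Barycentric refinements -/

/-- The Barycentric refinement of `K`: its vertices are the faces of `K`, and its faces are the
non-empty finite sets of faces of `K` that are pairwise contained in each other. -/
def barycentricRefinement {V : Type} (K : PreAbstractSimplicialComplex V) :
    PreAbstractSimplicialComplex (Finset V) where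
  faces := {c | c.Nonempty ∧ (∀ s ∈ c, s ∈ K.faces) ∧ IsChain (· ⊆ ·) (c : Set (Finset V))}
  isRelLowerSet_faces := by
    rintro c ⟨hc, hK, hch⟩
    refine ⟨hc, fun t htc ht => ⟨ht, fun s hs => hK s (htc hs), hch.mono ?_⟩⟩
    exact_mod_cast htc

/-- The type carrying the vertices of the `m`-th Barycentric refinement. -/
def RefinedVertex (V : Type) : ℕ → Type
  | 0 => V
  | m + 1 => Finset (RefinedVertex V m)

instance RefinedVertex.finite (V : Type) [Finite V] : (m : ℕ) → Finite (RefinedVertex V m)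
  | 0 => inferInstanceAs (Finite V)
  | m + 1 =>
    haveI := RefinedVertex.finite V m
    inferInstanceAs (Finite (Finset (RefinedVertex V m)))

/-- The `m`-th iterated Barycentric refinement of `K`. -/
def iteratedRefinement {V : Type} (K : PreAbstractSimplicialComplex V) :
    (m : ℕ) → PreAbstractSimplicialComplex (RefinedVertex V m)
  | 0 => K
  | m + 1 => barycentricRefinement (iteratedRefinement K m)

/-! ### The lattice and operators on `ℓ²(ℤ^d)` -/

/-- The faces of a nearest neighbour complex in their linear (respectively cyclic) order:
`2a ↦ {a}` and `2a + 1 ↦ {a, a + 1}`. -/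
def orderedFace (R : Type) [AddGroupWithOne R] (j : ℤ) : (nearestNeighborComplex R).faces :=
  letI := Classical.decEq R
  ⟨{((j / 2 : ℤ) : R), (((j + 1) / 2 : ℤ) : R)}, by
    refine ⟨((j / 2 : ℤ) : R), ?_⟩
    rcases Int.emod_two_eq_zero_or_one j with h | h
    · left
      have : (j + 1) / 2 = j / 2 := by omega
      rw [this]
      simp
    · right
      have : (j + 1) / 2 = j / 2 + 1 := by omega
      rw [this]
      simp⟩

/-- The cells of the `d`-th power of a nearest neighbour complex, labelled by `ℤ^d`. -/
def orderedCell (R : Type) [AddGroupWithOne R] {d : ℕ} (j : Fin d → ℤ) :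
    Cell (nearestNeighborComplex R) d :=
  fun k => orderedFace R (j k)

/-- For the line, `orderedFace` lists every face exactly once. -/
theorem orderedFace_int_bijective : Function.Bijective (orderedFace ℤ) := by
  have key : ∀ j x : ℤ, x ∈ (orderedFace ℤ j : Finset ℤ) ↔ x = j / 2 ∨ x = (j + 1) / 2 := by
    intro j x
    simp [orderedFace]
  constructor
  · intro i j h
    have h' : ∀ x : ℤ, (x = i / 2 ∨ x = (i + 1) / 2) ↔ (x = j / 2 ∨ x = (j + 1) / 2) := by
      intro x
      rw [← key, ← key, h]
    have h1 := (h' (i / 2)).1 (Or.inl rfl)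
    have h2 := (h' ((i + 1) / 2)).1 (Or.inr rfl)
    have h3 := (h' (j / 2)).2 (Or.inl rfl)
    have h4 := (h' ((j + 1) / 2)).2 (Or.inr rfl)
    omega
  · rintro ⟨s, a, hs | hs⟩
    · refine ⟨2 * a, Subtype.ext (Finset.ext fun x => ?_)⟩
      rw [key, ← Finset.mem_coe, hs, Set.mem_singleton_iff]
      omega
    · refine ⟨2 * a + 1, Subtype.ext (Finset.ext fun x => ?_)⟩
      rw [key, ← Finset.mem_coe, hs, Set.mem_insert_iff, Set.mem_singleton_iff]
      omega

/-- For the lattice `ℤ^d`, `orderedCell` lists every cell exactly once. -/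
theorem orderedCell_int_bijective (d : ℕ) :
    Function.Bijective (fun j : Fin d → ℤ => orderedCell ℤ j) :=
  Function.Bijective.piMap (fun _ => orderedFace_int_bijective)

/-- The Hilbert space `ℓ²(ℤ^d)`. -/
abbrev LatticeHilbert (d : ℕ) : Type := lp (fun _ : Fin d → ℤ => ℂ) 2

/-- The matrix entry `⟨e_i, A e_j⟩` of a bounded operator `A` on `ℓ²(ℤ^d)`. -/
def latticeEntry {d : ℕ} (A : LatticeHilbert d →L[ℂ] LatticeHilbert d) (i j : Fin d → ℤ) : ℂ :=
  (A (lp.single 2 j (1 : ℂ)) : ∀ _ : Fin d → ℤ, ℂ) i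

/-- A bounded operator on `ℓ²(ℤ^d)` is almost periodic over the compact group `𝔻₂^d` of dyadic
integers if its translates by `m ∈ ℤ^d`, whose entries are `A (i + m) (j + m)`, extend to a norm
continuous family of bounded operators indexed by `𝔻₂^d`, equivariant under the `ℤ^d`-action by
group translations. In particular, the entries `A m (m + k)` are then `h_k (T^m 0)` with `h_k`
continuous on `𝔻₂^d`. -/
def IsDyadicAlmostPeriodic {d : ℕ} (A : LatticeHilbert d →L[ℂ] LatticeHilbert d) : Prop :=
  ∃ F : (Fin d → ℤ_[2]) → (LatticeHilbert d →L[ℂ] LatticeHilbert d),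
    Continuous F ∧ F 0 = A ∧
      ∀ (x : Fin d → ℤ_[2]) (m i j : Fin d → ℤ),
        latticeEntry (F (x + fun k => ((m k : ℤ) : ℤ_[2]))) i j =
          latticeEntry (F x) (i + m) (j + m)

end

noncomputable section

/-! ### Cyclic orders on one-dimensional complexes -/

/-! Two products of faces intersect exactly when all their factors intersect, so the connection
Laplacian of `K^d` is the `d`-th tensor power of the connection matrix of `K`
(`connectionLaplacian_apply`). Everything reduces to a single cycle or line.

A Barycentric refinement of a cycle of length `N` is a cycle of length `2 * N`, since consecutive
faces are nested and no other chains occur. `IsCyclicOrder` records a cyclic labelling of the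
vertices, passes to refinements, and covers the line as `N = 0`; both limits thus become statements
about cycles whose lengths tend to infinity.

Finite spectra: splitting the faces into vertices and edges makes the connection matrix block
circulant. The Fourier transform leaves `2 × 2` blocks of trace `2c` and determinant `-1`, where `c
= 1 + cos θ` lies in `[0, 2]`. The eigenvalues `c ± √(c ^ 2 + 1)` have absolute value at least `√5 -
2 > 4 / 17 > 1 / 5`, which is the gap. They are the values of one function `dispersion` on an
equidistant grid in `[0, 1)`, so the density of states of `K^d` is the law of `∏ dispersion
(gridFloor x_k)` for independent uniform `x_k`. Dominated convergence gives the law of `∏ dispersion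
x_k` as limit. It is absolutely continuous because `dispersion` has nonzero derivative off a
countable set and never vanishes.

The infinite operator: the kernel on `ℤ` has range two and an explicit inverse of range two. A
weighted Schur test bounds the tensor power of the inverse by `(17 / 4) ^ d < 5 ^ d`, and a Neumann
series gives the gap. The kernel on `ℤ` is invariant under even translations, so the dyadic family
depends only on residues modulo two. -/

/-- The face with the label `j` for a labelling `u` of vertices: `2a ↦ {u a}` and
`2a + 1 ↦ {u a, u (a + 1)}`. -/
def labelledFace {V : Type} (u : ℤ → V) (j : ℤ) : Finset V :=
  letI := Classical.decEq V
  {u (j / 2), u ((j + 1) / 2)}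

theorem mem_labelledFace {V : Type} {u : ℤ → V} {j : ℤ} {x : V} :
    x ∈ labelledFace u j ↔ x = u (j / 2) ∨ x = u ((j + 1) / 2) := by
  simp [labelledFace]

theorem mem_labelledFace_two_mul {V : Type} {u : ℤ → V} {a : ℤ} {x : V} :
    x ∈ labelledFace u (2 * a) ↔ x = u a := by
  rw [mem_labelledFace, show 2 * a / 2 = a by omega, show (2 * a + 1) / 2 = a by omega, or_self]

theorem mem_labelledFace_two_mul_add_one {V : Type} {u : ℤ → V} {a : ℤ} {x : V} :
    x ∈ labelledFace u (2 * a + 1) ↔ x = u a ∨ x = u (a + 1) := by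
  rw [mem_labelledFace, show (2 * a + 1) / 2 = a by omega,
    show (2 * a + 1 + 1) / 2 = a + 1 by omega]

/-- The labelling `u` of the vertices of `K` by `ℤ` is `N`-periodic, injective modulo `N`, and the
faces of `K` are the vertices and the pairs of consecutive vertices. For `N = 0`, the complex `K` is
a line; for `N ≥ 3`, it is a cycle of length `N`. -/
structure IsCyclicOrder {V : Type} (K : PreAbstractSimplicialComplex V) (N : ℕ) (u : ℤ → V) :
    Prop where
  eq_iff : ∀ a b : ℤ, u a = u b ↔ (N : ℤ) ∣ a - b
  mem_faces : ∀ s : Finset V, s ∈ K.faces ↔ ∃ j : ℤ, s = labelledFace u j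

theorem mem_faces_nearestNeighborComplex {R : Type} [AddGroupWithOne R]
    (hR : Function.Surjective (Int.cast : ℤ → R)) (s : Finset R) :
    s ∈ (nearestNeighborComplex R).faces ↔ ∃ j : ℤ, s = labelledFace (Int.cast : ℤ → R) j := by
  constructor
  · rintro ⟨a, h | h⟩ <;> obtain ⟨b, rfl⟩ := hR a
    · refine ⟨2 * b, Finset.ext fun x => ?_⟩
      rw [mem_labelledFace_two_mul, ← Finset.mem_coe, h, Set.mem_singleton_iff]
    · refine ⟨2 * b + 1, Finset.ext fun x => ?_⟩
      rw [mem_labelledFace_two_mul_add_one, ← Finset.mem_coe, h]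
      simp
  · rintro ⟨j, rfl⟩
    obtain ⟨b, rfl | rfl⟩ := Int.even_or_odd' j
    · refine ⟨(b : R), Or.inl (Set.ext fun x => ?_)⟩
      rw [Finset.mem_coe, mem_labelledFace_two_mul, Set.mem_singleton_iff]
    · refine ⟨(b : R), Or.inr (Set.ext fun x => ?_)⟩
      rw [Finset.mem_coe, mem_labelledFace_two_mul_add_one]
      simp

theorem isCyclicOrder_lineComplex : IsCyclicOrder lineComplex 0 (Int.cast : ℤ → ℤ) where
  eq_iff a b := by simp [sub_eq_zero]
  mem_faces := mem_faces_nearestNeighborComplex fun a => ⟨a, rfl⟩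

theorem isCyclicOrder_circularComplex (n : ℕ) :
    IsCyclicOrder (circularComplex n) n (Int.cast : ℤ → ZMod n) where
  eq_iff a b := by
    rw [eq_comm, ZMod.intCast_eq_intCast_iff_dvd_sub]
  mem_faces := mem_faces_nearestNeighborComplex ZMod.intCast_surjective

theorem labelledFace_nonempty {V : Type} (u : ℤ → V) (j : ℤ) : (labelledFace u j).Nonempty :=
  ⟨u (j / 2), mem_labelledFace.2 (Or.inl rfl)⟩

namespace IsCyclicOrder

variable {V : Type} {K : PreAbstractSimplicialComplex V} {N : ℕ} {u : ℤ → V}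

theorem ne_add_one (h : IsCyclicOrder K N u) (hN : N ≠ 1) (a : ℤ) : u a ≠ u (a + 1) := by
  rw [Ne, h.eq_iff, show a - (a + 1) = -1 by ring, dvd_neg]
  intro h1
  exact hN (by exact_mod_cast Int.eq_one_of_dvd_one (by positivity) h1)

/-- The only proper inclusions go from an endpoint into its edge; `N ≠ 1` rules out loops, for which
an edge would collapse to a vertex. -/
theorem labelledFace_subset (h : IsCyclicOrder K N u) (hN : N ≠ 1) {i j : ℤ}
    (hij : labelledFace u i ⊆ labelledFace u j) :
    labelledFace u i = labelledFace u j ∨ ∃ b, j = 2 * b + 1 ∧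
      (labelledFace u i = labelledFace u (2 * b) ∨
        labelledFace u i = labelledFace u (2 * b + 2)) := by
  obtain ⟨a, rfl | rfl⟩ := Int.even_or_odd' i <;> obtain ⟨b, rfl | rfl⟩ := Int.even_or_odd' j
  · left
    have := hij (mem_labelledFace_two_mul.2 rfl)
    rw [mem_labelledFace_two_mul] at this
    ext x
    rw [mem_labelledFace_two_mul, mem_labelledFace_two_mul, this]
  · right
    refine ⟨b, rfl, ?_⟩
    have := hij (mem_labelledFace_two_mul.2 rfl)
    rw [mem_labelledFace_two_mul_add_one] at this
    refine this.imp (fun h1 => ?_) (fun h1 => ?_) <;> ext x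
    · rw [mem_labelledFace_two_mul, mem_labelledFace_two_mul, h1]
    · rw [show 2 * b + 2 = 2 * (b + 1) by ring, mem_labelledFace_two_mul,
        mem_labelledFace_two_mul, h1]
  · exfalso
    have h1 := hij (mem_labelledFace_two_mul_add_one.2 (Or.inl rfl))
    have h2 := hij (mem_labelledFace_two_mul_add_one.2 (Or.inr rfl))
    rw [mem_labelledFace_two_mul] at h1 h2
    exact h.ne_add_one hN a (h1.trans h2.symm)
  · left
    have h1 := hij (mem_labelledFace_two_mul_add_one.2 (Or.inl rfl))
    have h2 := hij (mem_labelledFace_two_mul_add_one.2 (Or.inr rfl))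
    rw [mem_labelledFace_two_mul_add_one] at h1 h2
    have h3 := h.ne_add_one hN a
    ext x
    rw [mem_labelledFace_two_mul_add_one, mem_labelledFace_two_mul_add_one]
    rcases h1 with h1 | h1 <;> rcases h2 with h2 | h2
    · exact absurd (h1.trans h2.symm) h3
    · rw [h1, h2]
    · rw [h1, h2, or_comm]
    · exact absurd (h1.trans h2.symm) h3

/-- Parity of the label separates vertices from edges as long as there are no loops, and an edge
determines its first vertex unless it can be traversed in both directions, which happens only for `N
= 2`. -/
theorem labelledFace_eq_iff (h : IsCyclicOrder K N u) (hN : N ≠ 1) (hN' : N ≠ 2) (i j : ℤ) :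
    labelledFace u i = labelledFace u j ↔ ((2 * N : ℕ) : ℤ) ∣ i - j := by
  constructor
  · intro hij
    have key : ∀ x, x ∈ labelledFace u i ↔ x ∈ labelledFace u j := fun x => by rw [hij]
    obtain ⟨a, rfl | rfl⟩ := Int.even_or_odd' i <;> obtain ⟨b, rfl | rfl⟩ := Int.even_or_odd' j <;>
      simp only [mem_labelledFace_two_mul, mem_labelledFace_two_mul_add_one] at key
    · rw [← mul_sub, Nat.cast_mul]
      exact mul_dvd_mul_left _ ((h.eq_iff a b).1 ((key _).1 rfl))
    · exact absurd (((key _).2 (Or.inl rfl)).trans ((key _).2 (Or.inr rfl)).symm)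
        (h.ne_add_one hN b)
    · exact absurd (((key _).1 (Or.inl rfl)).trans ((key _).1 (Or.inr rfl)).symm)
        (h.ne_add_one hN a)
    · rw [add_sub_add_right_eq_sub, ← mul_sub, Nat.cast_mul]
      refine mul_dvd_mul_left _ ?_
      rcases (key _).1 (Or.inl rfl) with h1 | h1
      · exact (h.eq_iff a b).1 h1
      · exfalso
        rcases (key _).1 (Or.inr rfl) with h2 | h2
        -- The two edges coincide with reversed orientation; subtracting the congruences gives `N ∣
        -- 2`.
        · rw [h.eq_iff] at h1 h2
          have h3 := dvd_sub h2 h1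
          rw [show a + 1 - b - (a - (b + 1)) = 2 by ring] at h3
          have h4 : N ∣ 2 := by exact_mod_cast h3
          rcases (Nat.dvd_prime Nat.prime_two).1 h4 with h5 | h5
          · exact hN h5
          · exact hN' h5
        · exact h.ne_add_one hN a (h1.trans h2.symm)
  · rintro ⟨k, hk⟩
    have hi : i = j + 2 * (N * k) := by push_cast at hk; linarith
    have h1 : u (i / 2) = u (j / 2) := by
      rw [h.eq_iff]; exact ⟨k, by omega⟩
    have h2 : u ((i + 1) / 2) = u ((j + 1) / 2) := by
      rw [h.eq_iff]; exact ⟨k, by omega⟩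
    rw [labelledFace, labelledFace, h1, h2]

theorem labelledFace_mem (h : IsCyclicOrder K N u) (j : ℤ) : labelledFace u j ∈ K.faces :=
  (h.mem_faces _).2 ⟨j, rfl⟩

/-- The cyclic labelling of the faces. -/
def face (h : IsCyclicOrder K N u) (j : ℤ) : K.faces :=
  ⟨labelledFace u j, h.labelledFace_mem j⟩

theorem face_surjective (h : IsCyclicOrder K N u) : Function.Surjective h.face := by
  rintro ⟨s, hs⟩
  obtain ⟨j, rfl⟩ := (h.mem_faces s).1 hs
  exact ⟨j, rfl⟩

theorem face_eq_iff (h : IsCyclicOrder K N u) (hN : N ≠ 1) (hN' : N ≠ 2) (i j : ℤ) :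
    h.face i = h.face j ↔ ((2 * N : ℕ) : ℤ) ∣ i - j := by
  rw [← h.labelledFace_eq_iff hN hN', Subtype.ext_iff]
  rfl

/-! ### Barycentric refinement of a cycle -/

theorem isChain_labelledFace (u : ℤ → V) (b : ℤ) :
    labelledFace u b ⊆ labelledFace u (b + 1) ∨ labelledFace u (b + 1) ⊆ labelledFace u b := by
  obtain ⟨a, rfl | rfl⟩ := Int.even_or_odd' b
  · left
    intro x
    rw [mem_labelledFace_two_mul, mem_labelledFace_two_mul_add_one]
    exact Or.inl
  · right
    intro x
    rw [show 2 * a + 1 + 1 = 2 * (a + 1) by ring, mem_labelledFace_two_mul,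
      mem_labelledFace_two_mul_add_one]
    exact Or.inr

/-- A chain of faces contains at most one edge and at most one vertex, since distinct edges and
distinct vertices are incomparable. So it is a single face or an edge with one of its endpoints, and
the latter are the pairs of faces with consecutive labels. -/
theorem barycentricRefinement (h : IsCyclicOrder K N u) (hN : N ≠ 1) (hN' : N ≠ 2) :
    IsCyclicOrder (barycentricRefinement K) (2 * N) (labelledFace u) where
  eq_iff := h.labelledFace_eq_iff hN hN'
  mem_faces c := by
    constructor
    · rintro ⟨hne, hc, hch⟩
      have hc' : ∀ s ∈ c, ∃ j, s = labelledFace u j := fun s hs => (h.mem_faces s).1 (hc s hs)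
      have hcomp : ∀ s ∈ c, ∀ t ∈ c, s ⊆ t ∨ t ⊆ s := fun s hs t ht => hch.total hs ht
      by_cases hodd : ∃ b : ℤ, labelledFace u (2 * b + 1) ∈ c
      · obtain ⟨b, hb⟩ := hodd
        have key : ∀ s ∈ c, s = labelledFace u (2 * b + 1) ∨ s = labelledFace u (2 * b) ∨
            s = labelledFace u (2 * b + 2) := by
          intro s hs
          obtain ⟨j, rfl⟩ := hc' s hs
          rcases hcomp _ hs _ hb with h1 | h1
          · rcases h.labelledFace_subset hN h1 with h2 | ⟨b', hb', h2⟩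
            · exact Or.inl h2
            · obtain rfl : b = b' := by omega
              exact Or.inr h2
          · rcases h.labelledFace_subset hN h1 with h2 | ⟨b', rfl, h2⟩
            · exact Or.inl h2.symm
            · exfalso
              have h3 := h.ne_add_one hN b
              have h4 : ∀ e : ℤ, labelledFace u (2 * b + 1) ≠ labelledFace u (2 * e) := by
                intro e he
                have h5 := mem_labelledFace_two_mul.1
                  (he ▸ mem_labelledFace_two_mul_add_one.2 (Or.inl rfl))
                have h6 := mem_labelledFace_two_mul.1
                  (he ▸ mem_labelledFace_two_mul_add_one.2 (Or.inr rfl))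
                exact h3 (h5.trans h6.symm)
              rcases h2 with h2 | h2
              · exact h4 _ h2
              · exact h4 (b' + 1) (by rw [h2]; congr 1; ring)
        -- The chain contains the edge labelled `2 * b + 1`; it remains to see which endpoint, if
        -- any, accompanies it. Both cannot, as they are distinct vertices.
        by_cases h0 : labelledFace u (2 * b) ∈ c
        · have h2 : labelledFace u (2 * b + 2) ∉ c := by
            intro h2
            rw [show 2 * b + 2 = 2 * (b + 1) by ring] at h2
            rcases hcomp _ h0 _ h2 with h3 | h3
            · exact h.ne_add_one hN b
                (mem_labelledFace_two_mul.1 (h3 (mem_labelledFace_two_mul.2 rfl)))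
            · exact h.ne_add_one hN b
                (mem_labelledFace_two_mul.1 (h3 (mem_labelledFace_two_mul.2 rfl))).symm
          -- In the refinement the faces `2 * b` and `2 * b + 1` are consecutive vertices, and the
          -- edge joining them has the label `2 * (2 * b) + 1`.
          refine ⟨2 * (2 * b) + 1, Finset.ext fun s => ?_⟩
          rw [mem_labelledFace_two_mul_add_one]
          constructor
          · intro hs
            rcases key s hs with rfl | rfl | rfl
            · exact Or.inr rfl
            · exact Or.inl rfl
            · exact absurd hs h2
          · rintro (rfl | rfl) <;> assumption
        · by_cases h2 : labelledFace u (2 * b + 2) ∈ c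
          · refine ⟨2 * (2 * b + 1) + 1, Finset.ext fun s => ?_⟩
            rw [mem_labelledFace_two_mul_add_one, show 2 * b + 1 + 1 = 2 * b + 2 by ring]
            constructor
            · intro hs
              rcases key s hs with rfl | rfl | rfl
              · exact Or.inl rfl
              · exact absurd hs h0
              · exact Or.inr rfl
            · rintro (rfl | rfl) <;> assumption
          · refine ⟨2 * (2 * b + 1), Finset.ext fun s => ?_⟩
            rw [mem_labelledFace_two_mul]
            constructor
            · intro hs
              rcases key s hs with rfl | rfl | rfl
              · rfl
              · exact absurd hs h0
              · exact absurd hs h2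
            · rintro rfl
              exact hb
      · have hev : ∀ s ∈ c, ∃ a : ℤ, s = labelledFace u (2 * a) := by
          intro s hs
          obtain ⟨j, rfl⟩ := hc' s hs
          obtain ⟨a, rfl | rfl⟩ := Int.even_or_odd' j
          · exact ⟨a, rfl⟩
          · exact absurd ⟨a, hs⟩ hodd
        obtain ⟨s₀, hs₀⟩ := hne
        obtain ⟨a, rfl⟩ := hev s₀ hs₀
        refine ⟨2 * (2 * a), Finset.ext fun s => ?_⟩
        rw [mem_labelledFace_two_mul]
        constructor
        · intro hs
          obtain ⟨a', rfl⟩ := hev s hs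
          have : u a' = u a := by
            rcases hcomp _ hs _ hs₀ with h3 | h3
            · exact mem_labelledFace_two_mul.1 (h3 (mem_labelledFace_two_mul.2 rfl))
            · exact (mem_labelledFace_two_mul.1 (h3 (mem_labelledFace_two_mul.2 rfl))).symm
          ext x
          rw [mem_labelledFace_two_mul, mem_labelledFace_two_mul, this]
        · rintro rfl
          exact hs₀
    · rintro ⟨j, rfl⟩
      refine ⟨labelledFace_nonempty _ _, fun s hs => ?_, ?_⟩
      · rcases mem_labelledFace.1 hs with rfl | rfl <;> exact h.labelledFace_mem _
      · intro s hs t ht hst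
        rw [Finset.mem_coe] at hs ht
        obtain ⟨b, rfl | rfl⟩ := Int.even_or_odd' j
        · rw [mem_labelledFace_two_mul] at hs ht
          exact absurd (hs.trans ht.symm) hst
        · rw [mem_labelledFace_two_mul_add_one] at hs ht
          have := isChain_labelledFace u b
          rcases hs with rfl | rfl <;> rcases ht with rfl | rfl
          · exact absurd rfl hst
          · exact this
          · exact this.symm
          · exact absurd rfl hst

theorem exists_iteratedRefinement (h : IsCyclicOrder K N u) (hN : 3 ≤ N) (m : ℕ) :
    ∃ v : ℤ → RefinedVertex V m, IsCyclicOrder (iteratedRefinement K m) (N * 2 ^ m) v := by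
  induction m with
  | zero => exact ⟨u, by rw [pow_zero, mul_one]; exact h⟩
  | succ m ih =>
    obtain ⟨v, hv⟩ := ih
    have h3 : 3 ≤ N * 2 ^ m := hN.trans (Nat.le_mul_of_pos_right _ (by positivity))
    refine ⟨labelledFace v, ?_⟩
    rw [pow_succ, ← mul_assoc, mul_comm _ 2]
    exact hv.barycentricRefinement (by omega) (by omega)

/-- A cycle of length `N` has `N` vertices and `N` edges. -/
theorem natCard_faces (h : IsCyclicOrder K N u) (hN : 3 ≤ N) : Nat.card K.faces = 2 * N := by
  have : NeZero (2 * N) := ⟨by omega⟩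
  rw [← Nat.card_zmod (2 * N)]
  symm
  refine Nat.card_congr (Equiv.ofBijective (fun x : ZMod (2 * N) => h.face (x.cast : ℤ)) ⟨?_, ?_⟩)
  · intro x y hxy
    rw [h.face_eq_iff (by omega) (by omega), ← ZMod.intCast_eq_intCast_iff_dvd_sub] at hxy
    simpa using hxy.symm
  · intro s
    obtain ⟨j, rfl⟩ := h.face_surjective s
    refine ⟨(j : ZMod (2 * N)), ?_⟩
    show h.face _ = h.face j
    rw [h.face_eq_iff (by omega) (by omega), ← ZMod.intCast_eq_intCast_iff_dvd_sub]
    simp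

end IsCyclicOrder

/-! ### The connection Laplacian as a tensor power -/

open Classical in
/-- The connection matrix of a complex: it is one if two faces intersect and zero otherwise. -/
def connectionMatrix {V : Type} (K : PreAbstractSimplicialComplex V) :
    Matrix K.faces K.faces ℝ :=
  fun x y => if ∃ p, p ∈ (x : Finset V) ∧ p ∈ (y : Finset V) then 1 else 0

theorem PreAbstractSimplicialComplex.nonempty_coe {V : Type} {K : PreAbstractSimplicialComplex V}
    (x : K.faces) : (x : Finset V).Nonempty :=
  (K.isRelLowerSet_faces x.2).1

/-- A product of sets is nonempty iff all factors are, applied to the intersections of the factors.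
The summand `1` supplies the diagonal, where cells meet themselves because faces are nonempty. -/
theorem connectionLaplacian_apply {V : Type} (K : PreAbstractSimplicialComplex V) (d : ℕ)
    (x y : Cell K d) :
    connectionLaplacian K d x y = ∏ k, connectionMatrix K (x k) (y k) := by
  classical
  have hmeet : (x.toSet ∩ y.toSet).Nonempty ↔
      ∀ k, ∃ p, p ∈ (x k : Finset V) ∧ p ∈ (y k : Finset V) := by
    constructor
    · rintro ⟨p, hp, hq⟩ k
      exact ⟨p k, hp k, hq k⟩
    · intro h
      choose p hp hq using h
      exact ⟨p, hp, hq⟩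
  have hprod : ∏ k, connectionMatrix K (x k) (y k) =
      if (x.toSet ∩ y.toSet).Nonempty then (1 : ℝ) else 0 := by
    simp only [connectionMatrix, Finset.prod_ite_zero, hmeet, Finset.mem_univ, forall_const,
      Finset.prod_const_one]
  rw [hprod, connectionLaplacian, Matrix.add_apply, SimpleGraph.adjMatrix_apply]
  by_cases hxy : x = y
  · subst hxy
    have : (x.toSet ∩ x.toSet).Nonempty := by
      rw [hmeet]
      intro k
      obtain ⟨p, hp⟩ := PreAbstractSimplicialComplex.nonempty_coe (x k)
      exact ⟨p, hp, hp⟩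
    simpa using this
  · simp [hxy, connectionGraph]

theorem IsCyclicOrder.connectionMatrix_face {V : Type} {K : PreAbstractSimplicialComplex V} {N : ℕ}
    {u : ℤ → V} (h : IsCyclicOrder K N u) (i j : ℤ)
    [Decidable (∃ p q : ℤ, (p = i / 2 ∨ p = (i + 1) / 2) ∧ (q = j / 2 ∨ q = (j + 1) / 2) ∧
      (N : ℤ) ∣ p - q)] :
    connectionMatrix K (h.face i) (h.face j) =
      if ∃ p q : ℤ, (p = i / 2 ∨ p = (i + 1) / 2) ∧ (q = j / 2 ∨ q = (j + 1) / 2) ∧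
        (N : ℤ) ∣ p - q then 1 else 0 := by
  classical
  rw [connectionMatrix]
  congr 1
  simp only [face, mem_labelledFace, eq_iff_iff]
  constructor
  · rintro ⟨p, h1, h2⟩
    rcases h1 with rfl | rfl <;> rcases h2 with h2 | h2 <;>
      exact ⟨_, _, by tauto, by tauto, (h.eq_iff _ _).1 h2⟩
  · rintro ⟨p, q, h1, h2, h3⟩
    rw [← h.eq_iff] at h3
    refine ⟨u p, ?_, ?_⟩
    · rcases h1 with rfl | rfl <;> simp
    · rcases h2 with rfl | rfl <;> simp [h3]

/-! ### Bounded operators with a kernel of finite range -/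

/-- Schur test with weights, for a symmetric kernel with finite rows. -/
theorem exists_kernelOperator {ι : Type} (K : ι → ι → ℝ) (S : ι → Finset ι) (w : ι → ℝ) (ρ : ℝ)
    (hsymm : ∀ i j, K i j = K j i) (hS : ∀ i j, K i j ≠ 0 → j ∈ S i) (hw : ∀ i, 0 < w i)
    (hρ : 0 ≤ ρ) (hrow : ∀ i, ∑ j ∈ S i, |K i j| * w j ≤ ρ * w i) :
    ∃ A : lp (fun _ : ι => ℂ) 2 →L[ℂ] lp (fun _ : ι => ℂ) 2, ‖A‖ ≤ ρ ∧
      ∀ (f : lp (fun _ : ι => ℂ) 2) (i : ι), A f i = ∑ j ∈ S i, (K i j : ℂ) * f j := by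
  classical
  -- By symmetry the weighted row bound is also a column bound; rows outside `S j` contribute
  -- nothing.
  have hcol : ∀ (s : Finset ι) (j : ι), ∑ i ∈ s, |K i j| * w i ≤ ρ * w j := by
    intro s j
    refine le_trans ?_ (hrow j)
    rw [← Finset.sum_filter_of_ne (p := fun i => i ∈ S j) (s := s)]
    · simp_rw [hsymm _ j]
      refine Finset.sum_le_sum_of_subset_of_nonneg (fun i hi => (Finset.mem_filter.1 hi).2) ?_
      intro i _ _
      exact mul_nonneg (abs_nonneg _) (hw i).le
    · intro i _ hi
      refine hS j i ?_
      rw [hsymm]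
      intro h0
      simp [h0] at hi
  have hterm : ∀ (f : ι → ℂ) (i : ι), ‖∑ j ∈ S i, (K i j : ℂ) * f j‖ ^ 2 ≤
      ρ * ∑ j ∈ S i, (|K i j| * w i) * (‖f j‖ ^ 2 / w j) := by
    intro f i
    have h1 : ‖∑ j ∈ S i, (K i j : ℂ) * f j‖ ≤ ∑ j ∈ S i, |K i j| * ‖f j‖ :=
      (norm_sum_le _ _).trans (le_of_eq (Finset.sum_congr rfl fun j _ => by
        rw [norm_mul, Complex.norm_real, Real.norm_eq_abs]))
    -- Cauchy–Schwarz after writing `|K| ‖f‖` as the geometric mean of `|K| w` and `|K| ‖f‖ ^ 2 /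
    -- w`.
    have h2 : (∑ j ∈ S i, |K i j| * ‖f j‖) ^ 2 ≤
        (∑ j ∈ S i, |K i j| * w j) * ∑ j ∈ S i, |K i j| * (‖f j‖ ^ 2 / w j) := by
      refine Finset.sum_sq_le_sum_mul_sum_of_sq_le_mul _ ?_ ?_ ?_
      · exact fun j _ => mul_nonneg (abs_nonneg _) (hw j).le
      · exact fun j _ => mul_nonneg (abs_nonneg _) (div_nonneg (sq_nonneg _) (hw j).le)
      · intro j _
        have := (hw j).ne'
        refine le_of_eq ?_
        field_simp
    calc ‖∑ j ∈ S i, (K i j : ℂ) * f j‖ ^ 2 ≤ (∑ j ∈ S i, |K i j| * ‖f j‖) ^ 2 := by gcongr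
      _ ≤ _ := h2
      _ ≤ (ρ * w i) * ∑ j ∈ S i, |K i j| * (‖f j‖ ^ 2 / w j) := by
        refine mul_le_mul_of_nonneg_right (hrow i) (Finset.sum_nonneg fun j _ => ?_)
        exact mul_nonneg (abs_nonneg _) (div_nonneg (sq_nonneg _) (hw j).le)
      _ = _ := by
        rw [mul_assoc, Finset.mul_sum]
        congr 1
        exact Finset.sum_congr rfl fun j _ => by ring
  have hbound : ∀ (f : lp (fun _ : ι => ℂ) 2) (s : Finset ι),
      ∑ i ∈ s, ‖∑ j ∈ S i, (K i j : ℂ) * f j‖ ^ (2 : ℝ≥0∞).toReal ≤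
        (ρ * ‖f‖) ^ (2 : ℝ≥0∞).toReal := by
    intro f s
    simp only [ENNReal.toReal_ofNat, Real.rpow_ofNat]
    have hf : ∀ t : Finset ι, ∑ j ∈ t, ‖f j‖ ^ 2 ≤ ‖f‖ ^ 2 := by
      intro t
      have := lp.sum_rpow_le_norm_rpow (p := 2) (by norm_num) f t
      simpa using this
    calc ∑ i ∈ s, ‖∑ j ∈ S i, (K i j : ℂ) * f j‖ ^ 2
        ≤ ∑ i ∈ s, ρ * ∑ j ∈ S i, (|K i j| * w i) * (‖f j‖ ^ 2 / w j) :=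
          Finset.sum_le_sum fun i _ => hterm f i
      _ ≤ ∑ i ∈ s, ρ * ∑ j ∈ s.biUnion S, (|K i j| * w i) * (‖f j‖ ^ 2 / w j) := by
        refine Finset.sum_le_sum fun i hi => mul_le_mul_of_nonneg_left ?_ hρ
        refine Finset.sum_le_sum_of_subset_of_nonneg (Finset.subset_biUnion_of_mem S hi) ?_
        intro j _ _
        exact mul_nonneg (mul_nonneg (abs_nonneg _) (hw i).le)
          (div_nonneg (sq_nonneg _) (hw j).le)
      _ = ρ * ∑ j ∈ s.biUnion S, (∑ i ∈ s, |K i j| * w i) * (‖f j‖ ^ 2 / w j) := by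
        rw [← Finset.mul_sum, Finset.sum_comm]
        simp_rw [Finset.sum_mul]
      _ ≤ ρ * ∑ j ∈ s.biUnion S, ρ * ‖f j‖ ^ 2 := by
        refine mul_le_mul_of_nonneg_left (Finset.sum_le_sum fun j _ => ?_) hρ
        refine (mul_le_mul_of_nonneg_right (hcol s j)
          (div_nonneg (sq_nonneg _) (hw j).le)).trans (le_of_eq ?_)
        have := (hw j).ne'
        field_simp
      _ ≤ ρ * (ρ * ‖f‖ ^ 2) := by
        rw [← Finset.mul_sum]
        exact mul_le_mul_of_nonneg_left (mul_le_mul_of_nonneg_left (hf _) hρ) hρ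
      _ = (ρ * ‖f‖) ^ 2 := by ring
  let T : lp (fun _ : ι => ℂ) 2 →ₗ[ℂ] lp (fun _ : ι => ℂ) 2 :=
    { toFun := fun f => ⟨fun i => ∑ j ∈ S i, (K i j : ℂ) * f j, memℓp_gen' (hbound f)⟩
      map_add' := fun f g => by
        ext i
        simp only [lp.coeFn_add, Pi.add_apply, mul_add, Finset.sum_add_distrib]
      map_smul' := fun c f => by
        ext i
        simp only [lp.coeFn_smul, Pi.smul_apply, smul_eq_mul, RingHom.id_apply, Finset.mul_sum]
        exact Finset.sum_congr rfl fun j _ => by ring }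
  refine ⟨T.mkContinuous ρ fun f => ?_, T.mkContinuous_norm_le hρ _, fun f i => rfl⟩
  exact lp.norm_le_of_forall_sum_le (by norm_num) (mul_nonneg hρ (norm_nonneg _)) (hbound f)

/-! ### Matrix entries and tensor products of band kernels -/

variable {d : ℕ}

/-- Bounded operators are determined by their matrix entries. -/
theorem latticeEntry_ext {A B : LatticeHilbert d →L[ℂ] LatticeHilbert d}
    (h : ∀ i j, latticeEntry A i j = latticeEntry B i j) : A = B := by
  refine lp.ext_continuousLinearMap (by norm_num) fun j => ?_
  ext1
  exact lp.ext (funext fun i => h i j)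

theorem latticeEntry_eq_inner (A : LatticeHilbert d →L[ℂ] LatticeHilbert d) (i j : Fin d → ℤ) :
    latticeEntry A i j = inner ℂ (lp.single 2 i (1 : ℂ) : LatticeHilbert d)
      (A (lp.single 2 j (1 : ℂ))) := by
  rw [lp.inner_single_left]
  simp [latticeEntry]

theorem latticeEntry_one (i j : Fin d → ℤ) :
    latticeEntry (1 : LatticeHilbert d →L[ℂ] LatticeHilbert d) i j = if i = j then 1 else 0 := by
  rw [latticeEntry, one_apply_eq_self, lp.single_apply, Pi.single_apply]

theorem isSelfAdjoint_of_latticeEntry {A : LatticeHilbert d →L[ℂ] LatticeHilbert d}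
    (h : ∀ i j, latticeEntry A i j = starRingEnd ℂ (latticeEntry A j i)) : IsSelfAdjoint A := by
  rw [ContinuousLinearMap.isSelfAdjoint_iff']
  refine latticeEntry_ext fun i j => ?_
  rw [h i j, latticeEntry_eq_inner, latticeEntry_eq_inner, ContinuousLinearMap.adjoint_inner_right,
    inner_conj_symm]

/-- A real kernel on `ℤ` of range two with a weighted bound on its rows. -/
structure IsBandKernel (κ : ℤ → ℤ → ℝ) (w : ℤ → ℝ) (ρ : ℝ) : Prop where
  symm : ∀ i j, κ i j = κ j i
  band : ∀ i j, κ i j ≠ 0 → j ∈ Finset.Icc (i - 2) (i + 2)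
  pos : ∀ i, 0 < w i
  row : ∀ i, ∑ j ∈ Finset.Icc (i - 2) (i + 2), |κ i j| * w j ≤ ρ * w i

theorem sum_Icc_sub_two_add_two {M : Type} [AddCommMonoid M] (i : ℤ) (f : ℤ → M) :
    ∑ j ∈ Finset.Icc (i - 2) (i + 2), f j =
      f (i - 2) + (f (i - 1) + (f i + (f (i + 1) + f (i + 2)))) := by
  have : Finset.Icc (i - 2) (i + 2) = {i - 2, i - 1, i, i + 1, i + 2} := by
    ext x
    simp only [Finset.mem_Icc, Finset.mem_insert, Finset.mem_singleton]
    omega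
  rw [this, Finset.sum_insert, Finset.sum_insert, Finset.sum_insert, Finset.sum_insert,
    Finset.sum_singleton] <;> simp only [Finset.mem_insert, Finset.mem_singleton] <;> omega

theorem IsBandKernel.shift {κ : ℤ → ℤ → ℝ} {w : ℤ → ℝ} {ρ : ℝ} (h : IsBandKernel κ w ρ) (m : ℤ) :
    IsBandKernel (fun i j => κ (i + m) (j + m)) (fun i => w (i + m)) ρ where
  symm i j := h.symm _ _
  band i j hij := by
    have := h.band _ _ hij
    simp only [Finset.mem_Icc] at this ⊢
    omega
  pos i := h.pos _
  row i := by
    have := h.row (i + m)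
    rw [sum_Icc_sub_two_add_two] at this ⊢
    simpa only [add_sub_right_comm, add_right_comm _ m] using this

/-- The range of a tensor product of kernels of range two. -/
def latticeBox (i : Fin d → ℤ) : Finset (Fin d → ℤ) :=
  Fintype.piFinset fun k => Finset.Icc (i k - 2) (i k + 2)

/-- With product weights, the weighted row sums over a box factor into one-dimensional row sums, so
the Schur bounds multiply. -/
theorem exists_tensorOperator {κ : Fin d → ℤ → ℤ → ℝ} {w : Fin d → ℤ → ℝ} {ρ : ℝ} (hρ : 0 ≤ ρ)
    (h : ∀ k, IsBandKernel (κ k) (w k) ρ) :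
    ∃ A : LatticeHilbert d →L[ℂ] LatticeHilbert d, ‖A‖ ≤ ρ ^ d ∧
      (∀ (f : LatticeHilbert d) (i : Fin d → ℤ),
        A f i = ∑ j ∈ latticeBox i, ((∏ k, κ k (i k) (j k) : ℝ) : ℂ) * f j) ∧
      ∀ i j, latticeEntry A i j = ((∏ k, κ k (i k) (j k) : ℝ) : ℂ) := by
  have hS : ∀ i j : Fin d → ℤ, ∏ k, κ k (i k) (j k) ≠ 0 → j ∈ latticeBox i := by
    intro i j hij
    rw [latticeBox, Fintype.mem_piFinset]
    exact fun k => (h k).band _ _ (Finset.prod_ne_zero_iff.1 hij k (Finset.mem_univ k))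
  obtain ⟨A, hA, hA'⟩ := exists_kernelOperator (fun i j : Fin d → ℤ => ∏ k, κ k (i k) (j k))
    latticeBox (fun i => ∏ k, w k (i k)) (ρ ^ d)
    (fun i j => Finset.prod_congr rfl fun k _ => (h k).symm _ _) hS
    (fun i => Finset.prod_pos fun k _ => (h k).pos _) (pow_nonneg hρ d) (by
      intro i
      simp_rw [Finset.abs_prod, ← Finset.prod_mul_distrib]
      rw [latticeBox, ← Finset.prod_univ_sum (fun k => Finset.Icc (i k - 2) (i k + 2))
        (fun k j => |κ k (i k) j| * w k j)]
      calc _ ≤ ∏ k, ρ * w k (i k) := Finset.prod_le_prod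
            (fun k _ => Finset.sum_nonneg fun j _ => mul_nonneg (abs_nonneg _) ((h k).pos j).le)
            (fun k _ => (h k).row _)
        _ = _ := by simp [Finset.prod_mul_distrib])
  refine ⟨A, hA, hA', fun i j => ?_⟩
  rw [latticeEntry, hA']
  by_cases hij : j ∈ latticeBox i
  · rw [Finset.sum_eq_single_of_mem j hij]
    · simp
    · intro l _ hl
      rw [lp.single_apply_ne _ _ _ hl, mul_zero]
  · rw [Finset.sum_eq_zero, not_imp_comm.1 (hS i j) hij, Complex.ofReal_zero]
    intro l hl
    rw [lp.single_apply_ne _ _ _ (ne_of_mem_of_not_mem hl hij), mul_zero]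

theorem tensorOperator_mul_eq_one {κ κ' : Fin d → ℤ → ℤ → ℝ}
    (hinv : ∀ k i j, ∑ l ∈ Finset.Icc (i - 2) (i + 2), κ k i l * κ' k l j = if i = j then 1 else 0)
    {A B : LatticeHilbert d →L[ℂ] LatticeHilbert d}
    (hA : ∀ (f : LatticeHilbert d) (i : Fin d → ℤ),
      A f i = ∑ j ∈ latticeBox i, ((∏ k, κ k (i k) (j k) : ℝ) : ℂ) * f j)
    (hB : ∀ i j, latticeEntry B i j = ((∏ k, κ' k (i k) (j k) : ℝ) : ℂ)) :
    A * B = 1 := by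
  refine latticeEntry_ext fun i j => ?_
  rw [latticeEntry_one, latticeEntry, mul_apply_eq_comp, hA]
  change ∑ l ∈ latticeBox i, _ * latticeEntry B l j = _
  simp_rw [hB, ← Complex.ofReal_mul, ← Finset.prod_mul_distrib]
  rw [← Complex.ofReal_sum, latticeBox,
    ← Finset.prod_univ_sum (fun k => Finset.Icc (i k - 2) (i k + 2))
      (fun k l => κ k (i k) l * κ' k l (j k))]
  simp only [hinv, Finset.prod_ite_zero, funext_iff, Finset.mem_univ, forall_const,
    Finset.prod_const_one]
  split_ifs <;> simp

/-! ### The connection Laplacian of the line and its inverse -/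

/-- The kernel of the connection Laplacian of the line. -/
def lineKernel (i j : ℤ) : ℝ :=
  if (-1 ≤ i - j ∧ i - j ≤ 1) ∨ ((i - j = 2 ∨ j - i = 2) ∧ i % 2 = 1) then 1 else 0

/-- The kernel of the inverse of the connection Laplacian of the line. -/
def lineInverseKernel (i j : ℤ) : ℝ :=
  if i - j = 1 ∨ j - i = 1 then 1
  else if i = j ∨ ((i - j = 2 ∨ j - i = 2) ∧ i % 2 = 0) then -1 else 0

/-- The Perron eigenvalue of the block `!![1, 2; 2, 3]` at frequency zero is `2 + √5`, with
eigenvector in the golden ratio. The Fibonacci quotient `8 / 5` replaces it, edges getting the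
larger weight. The row sums are `21 ≤ 17 / 4 * 5` at vertices and `34 = 17 / 4 * 8` at edges. -/
theorem isBandKernel_lineKernel :
    IsBandKernel lineKernel (fun i => if i % 2 = 1 then 8 else 5) (17 / 4) where
  symm i j := by
    unfold lineKernel
    congr 1
    apply propext
    omega
  band i j h := by
    unfold lineKernel at h
    rw [Finset.mem_Icc]
    split_ifs at h
    · omega
    · exact absurd rfl h
  pos i := by split_ifs <;> norm_num
  row i := by
    rw [sum_Icc_sub_two_add_two]
    rcases Int.emod_two_eq_zero_or_one i with hi | hi
    · have h : ∀ b : ℤ, (i + b) % 2 = b % 2 := fun b => by omega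
      simp [lineKernel, h, hi, sub_eq_add_neg]
      norm_num
    · have h : ∀ b : ℤ, (i + b) % 2 = (b + 1) % 2 := fun b => by omega
      simp [lineKernel, h, hi, sub_eq_add_neg]
      norm_num

/-- Up to signs the inverse kernel is the kernel itself with vertices and edges exchanged, so the
same weights work after swapping parities. -/
theorem isBandKernel_lineInverseKernel :
    IsBandKernel lineInverseKernel (fun i => if i % 2 = 0 then 8 else 5) (17 / 4) where
  symm i j := by
    unfold lineInverseKernel
    congr 1
    · apply propext
      omega
    · congr 1
      apply propext
      omega
  band i j h := by
    unfold lineInverseKernel at h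
    rw [Finset.mem_Icc]
    split_ifs at h
    · omega
    · omega
    · exact absurd rfl h
  pos i := by split_ifs <;> norm_num
  row i := by
    rw [sum_Icc_sub_two_add_two]
    rcases Int.emod_two_eq_zero_or_one i with hi | hi
    · have h : ∀ b : ℤ, (i + b) % 2 = b % 2 := fun b => by omega
      simp [lineInverseKernel, h, hi, sub_eq_add_neg]
      norm_num
    · have h : ∀ b : ℤ, (i + b) % 2 = (b + 1) % 2 := fun b => by omega
      simp [lineInverseKernel, h, hi, sub_eq_add_neg]
      norm_num

theorem sum_lineKernel_mul_lineInverseKernel (i j : ℤ) :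
    ∑ l ∈ Finset.Icc (i - 2) (i + 2), lineKernel i l * lineInverseKernel l j =
      if i = j then 1 else 0 := by
  -- Both kernels have range two, so the product can be nonzero only up to distance four; by
  -- periodicity this leaves nine offsets for each parity of `i`.
  by_cases hj : -4 ≤ j - i ∧ j - i ≤ 4
  · rw [sum_Icc_sub_two_add_two]
    obtain ⟨e, rfl⟩ : ∃ e, j = i + e := ⟨j - i, by ring⟩
    rw [add_sub_cancel_left] at hj
    obtain ⟨h1, h2⟩ := hj
    have h' : ∀ a b : ℤ, i + a + (b + -i) = a + b := fun a b => by ring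
    rcases Int.emod_two_eq_zero_or_one i with hi | hi
    · have h : ∀ b : ℤ, (i + b) % 2 = b % 2 := fun b => by omega
      interval_cases e <;> simp [lineKernel, lineInverseKernel, h, h', hi, sub_eq_add_neg]
    · have h : ∀ b : ℤ, (i + b) % 2 = (b + 1) % 2 := fun b => by omega
      interval_cases e <;> simp [lineKernel, lineInverseKernel, h, h', hi, sub_eq_add_neg]
  · rw [if_neg (by omega), Finset.sum_eq_zero]
    intro l hl
    rw [Finset.mem_Icc] at hl
    rw [lineInverseKernel, if_neg (by omega), if_neg (by omega), mul_zero]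

/-- This is the transpose of the previous identity, since both kernels are symmetric; the summation
window moves from `j` to `i` because the terms vanish off the common part. -/
theorem sum_lineInverseKernel_mul_lineKernel (i j : ℤ) :
    ∑ l ∈ Finset.Icc (i - 2) (i + 2), lineInverseKernel i l * lineKernel l j =
      if i = j then 1 else 0 := by
  have h1 : ∀ l ∈ Finset.Icc (i - 2) (i + 2), l ∉ Finset.Icc (j - 2) (j + 2) →
      lineInverseKernel i l * lineKernel l j = 0 := by
    intro l _ hl
    rw [isBandKernel_lineKernel.symm, not_imp_comm.1 (isBandKernel_lineKernel.band _ _) hl,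
      mul_zero]
  have h2 : ∀ l ∈ Finset.Icc (j - 2) (j + 2), l ∉ Finset.Icc (i - 2) (i + 2) →
      lineInverseKernel i l * lineKernel l j = 0 := by
    intro l _ hl
    rw [not_imp_comm.1 (isBandKernel_lineInverseKernel.band _ _) hl, zero_mul]
  rw [Finset.sum_congr_of_eq_on_inter h1 h2 fun _ _ _ => rfl]
  have := sum_lineKernel_mul_lineInverseKernel j i
  simp_rw [eq_comm (a := i) (b := j), ← this]
  refine Finset.sum_congr rfl fun l _ => ?_
  rw [mul_comm, isBandKernel_lineKernel.symm, isBandKernel_lineInverseKernel.symm]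

theorem IsCyclicOrder.connectionMatrix_face_eq_lineKernel {V : Type}
    {K : PreAbstractSimplicialComplex V} {N : ℕ} {u : ℤ → V} (h : IsCyclicOrder K N u) (i j : ℤ)
    (hN : N = 0 ∨ |i| + |j| + 2 < N) :
    connectionMatrix K (h.face i) (h.face j) = lineKernel i j := by
  classical
  rw [h.connectionMatrix_face, lineKernel]
  congr 1
  apply propext
  constructor
  · rintro ⟨p, q, hp, hq, hpq⟩
    -- The labels are small compared with `N`, so vertices that agree modulo `N` agree as integers:
    -- the cycle does not close up within this window.
    have : p - q = 0 := by
      rcases hN with rfl | hN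
      · simpa using hpq
      · refine Int.eq_zero_of_abs_lt_dvd hpq (abs_lt.2 ?_)
        have h1 := abs_le.1 (le_refl |i|)
        have h2 := abs_le.1 (le_refl |j|)
        omega
    omega
  · intro hij
    by_contra hc
    have key : ∀ p, (p = i / 2 ∨ p = (i + 1) / 2) → ¬(p = j / 2 ∨ p = (j + 1) / 2) :=
      fun p h1 h2 => hc ⟨p, p, h1, h2, by simp⟩
    have h1 := key (i / 2) (Or.inl rfl)
    have h2 := key ((i + 1) / 2) (Or.inr rfl)
    omega

/-- The entries of the connection Laplacians of cycles converge to those of the line when the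
lengths of the cycles tend to infinity. -/
theorem tendsto_connectionLaplacian_face {d : ℕ} {V : ℕ → Type}
    {K : (m : ℕ) → PreAbstractSimplicialComplex (V m)} {N : ℕ → ℕ} {u : (m : ℕ) → ℤ → V m}
    (h : ∀ m, IsCyclicOrder (K m) (N m) (u m)) (hN : Filter.Tendsto N Filter.atTop Filter.atTop)
    (i j : Fin d → ℤ) :
    Filter.Tendsto
      (fun m => ((connectionLaplacian (K m) d (fun k => (h m).face (i k))
        (fun k => (h m).face (j k)) : ℝ) : ℂ))
      Filter.atTop (nhds ((∏ k, lineKernel (i k) (j k) : ℝ) : ℂ)) := by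
  -- For fixed labels the entries are eventually constant, once the cycle is longer than the window
  -- containing all the labels.
  refine tendsto_nhds_of_eventually_eq ?_
  have hev : ∀ᶠ m in Filter.atTop, ∀ k : Fin d, |i k| + |j k| + 2 < (N m : ℤ) := by
    rw [Filter.eventually_all]
    intro k
    filter_upwards [hN.eventually_gt_atTop (|i k| + |j k| + 2).toNat] with m hm
    exact (Int.self_le_toNat _).trans_lt (by exact_mod_cast hm)
  filter_upwards [hev] with m hm
  exact congrArg _ ((connectionLaplacian_apply _ _ _ _).trans (Finset.prod_congr rfl fun k _ =>
    (h m).connectionMatrix_face_eq_lineKernel _ _ (Or.inr (hm k))))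

/-! ### The limiting operator: almost periodicity, inverse and gap -/

theorem lineKernel_add_of_even (i j : ℤ) {m : ℤ} (hm : Even m) :
    lineKernel (i + m) (j + m) = lineKernel i j := by
  obtain ⟨a, rfl⟩ := hm
  unfold lineKernel
  congr 1
  apply propext
  omega

theorem PadicInt.toZMod_eq_of_norm_sub_lt_one {p : ℕ} [Fact p.Prime] {x y : ℤ_[p]}
    (h : ‖x - y‖ < 1) : PadicInt.toZMod x = PadicInt.toZMod y := by
  rw [← sub_eq_zero, ← map_sub, ← RingHom.mem_ker, PadicInt.ker_toZMod,
    IsLocalRing.mem_maximalIdeal]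
  exact PadicInt.mem_nonunits.2 h

/-- The connection Laplacian of the lattice as a bounded operator. -/
theorem exists_latticeLaplacian (d : ℕ) (hd : 1 ≤ d) :
    ∃ L : LatticeHilbert d →L[ℂ] LatticeHilbert d,
      (∀ i j, latticeEntry L i j = ((∏ k, lineKernel (i k) (j k) : ℝ) : ℂ)) ∧
      IsSelfAdjoint L ∧ IsDyadicAlmostPeriodic L ∧ IsUnit L ∧
      ∀ t : ℝ, t ∈ Set.Icc (-(1 / 5 ^ d : ℝ)) (1 / 5 ^ d) → (t : ℂ) ∉ spectrum ℂ L := by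
  have hex : ∀ m : Fin d → ℤ, ∃ A : LatticeHilbert d →L[ℂ] LatticeHilbert d,
      (∀ (f : LatticeHilbert d) (i : Fin d → ℤ), A f i =
        ∑ j ∈ latticeBox i, ((∏ k, lineKernel (i k + m k) (j k + m k) : ℝ) : ℂ) * f j) ∧
      ∀ i j, latticeEntry A i j = ((∏ k, lineKernel (i k + m k) (j k + m k) : ℝ) : ℂ) := by
    intro m
    obtain ⟨A, -, hA⟩ := exists_tensorOperator (d := d) (by norm_num)
      fun k => isBandKernel_lineKernel.shift (m k)
    exact ⟨A, hA⟩
  choose G hG hG' using hex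
  obtain ⟨M, hM, hM', hM''⟩ := exists_tensorOperator (d := d) (by norm_num)
    fun _ => isBandKernel_lineInverseKernel
  have hL : ∀ i j, latticeEntry (G 0) i j = ((∏ k, lineKernel (i k) (j k) : ℝ) : ℂ) := by
    intro i j
    simp [hG']
  have hLM : G 0 * M = 1 :=
    tensorOperator_mul_eq_one (fun _ => sum_lineKernel_mul_lineInverseKernel)
      (fun f i => by simpa using hG 0 f i) hM''
  have hML : M * G 0 = 1 :=
    tensorOperator_mul_eq_one (fun _ => sum_lineInverseKernel_mul_lineKernel) hM' hL
  have hunit : IsUnit (G 0) := ⟨⟨G 0, M, hLM, hML⟩, rfl⟩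
  refine ⟨G 0, hL, ?_, ?_, hunit, ?_⟩
  · refine isSelfAdjoint_of_latticeEntry fun i j => ?_
    rw [hL, hL, Complex.conj_ofReal]
    simp_rw [isBandKernel_lineKernel.symm (j _)]
  -- The operator at `x` is the translate by the residues of `x` modulo two. It is locally constant
  -- in `x`, hence norm continuous.
  · refine ⟨fun x => G fun k => ((PadicInt.toZMod (x k)).val : ℤ), ?_, ?_, ?_⟩
    · refine IsLocallyConstant.continuous ((IsLocallyConstant.iff_eventually_eq _).2 fun x => ?_)
      have hev : ∀ᶠ y in nhds x, ∀ k, ‖y k - x k‖ < 1 := by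
        rw [Filter.eventually_all]
        intro k
        have hc : Continuous fun y : Fin d → ℤ_[2] => ‖y k - x k‖ := by fun_prop
        exact hc.continuousAt.eventually_lt continuousAt_const (by simp)
      filter_upwards [hev] with y hy
      congr 1
      funext k
      rw [PadicInt.toZMod_eq_of_norm_sub_lt_one (hy k)]
    · refine congrArg G (funext fun k => ?_)
      simp
    · intro x m i j
      rw [hG', hG']
      congr 1
      refine Finset.prod_congr rfl fun k _ => ?_
      -- Reducing `x + m` modulo two and adding `m` to the residue of `x` may differ as integers,
      -- but only by an even number, which the kernel does not see.
      have heven : Even (((PadicInt.toZMod (x k + ((m k : ℤ) : ℤ_[2]))).val : ℤ) -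
          (m k + ((PadicInt.toZMod (x k)).val : ℤ))) := by
        rw [even_iff_two_dvd]
        refine (ZMod.intCast_zmod_eq_zero_iff_dvd _ 2).1 ?_
        push_cast
        rw [ZMod.natCast_zmod_val, ZMod.natCast_zmod_val, map_add, map_intCast]
        ring
      have := lineKernel_add_of_even (i k + m k + ((PadicInt.toZMod (x k)).val : ℤ))
        (j k + m k + ((PadicInt.toZMod (x k)).val : ℤ)) heven
      simp only [Pi.add_apply]
      rw [← this]
      congr 1 <;> ring
  · intro t ht
    rw [spectrum.notMem_iff, Algebra.algebraMap_eq_smul_one]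
    -- With `M` the inverse of `L`, `t - L = -L (1 - t M)`; the second factor is invertible by a
    -- Neumann series, as `|t| ≤ 1 / 5 ^ d` and `‖M‖ ≤ (17 / 4) ^ d < 5 ^ d`.
    have hfac : (t : ℂ) • (1 : LatticeHilbert d →L[ℂ] LatticeHilbert d) - G 0 =
        -(G 0 * (1 - (t : ℂ) • M)) := by
      rw [mul_sub, mul_one, mul_smul_comm, hLM, neg_sub]
    rw [hfac, IsUnit.neg_iff]
    refine hunit.mul (isUnit_one_sub_of_norm_lt_one ?_)
    have h1 : ‖M‖ < 5 ^ d := hM.trans_lt (pow_lt_pow_left₀ (by norm_num) (by norm_num) (by omega))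
    have h2 : |t| ≤ 1 / 5 ^ d := abs_le.2 ht
    rw [norm_smul, Complex.norm_real, Real.norm_eq_abs]
    calc |t| * ‖M‖ ≤ 1 / 5 ^ d * ‖M‖ := by gcongr
      _ < 1 / 5 ^ d * 5 ^ d := by gcongr
      _ = 1 := by field_simp

/-! ### Spectra of tensor powers -/

theorem Matrix.roots_charpoly_diagonal {ι R : Type} [Fintype ι] [DecidableEq ι] [CommRing R]
    [IsDomain R] (w : ι → R) :
    (Matrix.diagonal w).charpoly.roots = Finset.univ.val.map w := by
  rw [Matrix.charpoly_diagonal, ← Polynomial.roots_multiset_prod_X_sub_C (Finset.univ.val.map w),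
    Multiset.map_map]
  rfl

theorem Matrix.IsHermitian.map_eigenvalues {ι : Type} [Fintype ι] [DecidableEq ι]
    {A : Matrix ι ι ℝ} (hA : A.IsHermitian) :
    Finset.univ.val.map hA.eigenvalues = A.charpoly.roots := by
  have h : A.charpoly.roots = _ := Matrix.IsHermitian.roots_charpoly_eq_eigenvalues (𝕜 := ℝ) hA
  rw [h]
  exact Multiset.map_congr rfl fun x _ => rfl

/-- Similar matrices have the same characteristic polynomial. The comparison is between multisets
because the indexing of `eigenvalues` carries no meaning for a given diagonalization. -/
theorem Matrix.IsHermitian.map_eigenvalues_of_conj_diagonal {ι : Type} [Fintype ι]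
    [DecidableEq ι] {A P Q : Matrix ι ι ℝ} (hA : A.IsHermitian) {w : ι → ℝ}
    (h : A = P * Matrix.diagonal w * Q) (hQP : Q * P = 1) :
    Finset.univ.val.map hA.eigenvalues = Finset.univ.val.map w := by
  have h1 : A.charpoly = (Matrix.diagonal w).charpoly := by
    rw [h, Matrix.charpoly_mul_comm, ← mul_assoc, hQP, one_mul]
  rw [hA.map_eigenvalues, h1, Matrix.roots_charpoly_diagonal]

instance {V : Type} [Finite V] (K : PreAbstractSimplicialComplex V) : Fintype K.faces :=
  Fintype.ofFinite _

instance {V : Type} (K : PreAbstractSimplicialComplex V) : DecidableEq K.faces :=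
  Classical.decEq _

/-- The tensor power of a matrix on the faces, as a matrix on the cells of `K^d`. -/
def cellPower {V : Type} {K : PreAbstractSimplicialComplex V} (d : ℕ)
    (A : Matrix K.faces K.faces ℝ) : Matrix (Cell K d) (Cell K d) ℝ :=
  fun x y => ∏ k, A (x k) (y k)

theorem connectionLaplacian_eq_cellPower {V : Type} {K : PreAbstractSimplicialComplex V} {d : ℕ} :
    connectionLaplacian K d = cellPower d (connectionMatrix K) := by
  ext x y
  rw [connectionLaplacian_apply, cellPower]

theorem connectionMatrix_isHermitian {V : Type} (K : PreAbstractSimplicialComplex V) :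
    (connectionMatrix K).IsHermitian := by
  ext x y
  simp only [connectionMatrix, Matrix.conjTranspose_apply, star_trivial]
  congr 1
  simp only [and_comm]

theorem cellPower_diagonal {V : Type} {K : PreAbstractSimplicialComplex V} {d : ℕ}
    (v : K.faces → ℝ) :
    cellPower d (Matrix.diagonal v) = Matrix.diagonal fun x : Cell K d => ∏ k, v (x k) := by
  ext x y
  simp only [cellPower, Matrix.diagonal_apply, Finset.prod_ite_zero, Finset.mem_univ, forall_const]
  congr 1
  exact propext ⟨fun h => funext fun k => h k (Finset.mem_univ k), fun h k _ => congrFun h k⟩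

theorem cellPower_one {V : Type} {K : PreAbstractSimplicialComplex V} {d : ℕ} :
    cellPower d (1 : Matrix K.faces K.faces ℝ) = 1 := by
  rw [← Matrix.diagonal_one, cellPower_diagonal]
  simp

section Tensor

variable {V : Type} [Finite V] {K : PreAbstractSimplicialComplex V} {d : ℕ}

theorem sum_cell {M : Type} [AddCommMonoid M] (f : (Fin d → K.faces) → M) :
    (∑ x : Cell K d, f x : M) = ∑ x : Fin d → K.faces, f x := by
  exact Fintype.sum_equiv (ι := Cell K d) (Equiv.refl (Fin d → K.faces)) _ f fun x => rfl

theorem card_cell : Fintype.card (Cell K d) = Fintype.card K.faces ^ d := by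
  have h : Fintype.card (Cell K d) = Fintype.card (Fin d → K.faces) :=
    Fintype.card_congr (Equiv.refl (Fin d → K.faces))
  rw [h, Fintype.card_fun, Fintype.card_fin]

/-- Multiplicativity of the tensor power is distributivity: a product of sums over faces is a sum
over cells. It turns a diagonalization of one factor into one of the power. -/
theorem cellPower_mul (A B : Matrix K.faces K.faces ℝ) :
    cellPower d (A * B) = cellPower d A * cellPower d B := by
  ext x y
  rw [Matrix.mul_apply]
  simp only [cellPower, Matrix.mul_apply, ← Finset.prod_mul_distrib]
  rw [Fintype.prod_sum]
  exact (sum_cell fun z => ∏ k, A (x k) (z k) * B (z k) (y k)).symm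

variable (K)

/-- The connection spectrum of a power consists of the products of the eigenvalues. -/
theorem eigenvalues_connectionLaplacian :
    Finset.univ.val.map (connectionLaplacian_isHermitian K d).eigenvalues =
      Finset.univ.val.map fun x : Cell K d =>
        ∏ k, (connectionMatrix_isHermitian K).eigenvalues (x k) := by
  let U := (connectionMatrix_isHermitian K).eigenvectorUnitary
  have hA : connectionMatrix K = (U : Matrix K.faces K.faces ℝ) *
      Matrix.diagonal (connectionMatrix_isHermitian K).eigenvalues *
      star (U : Matrix K.faces K.faces ℝ) := by
    have := (connectionMatrix_isHermitian K).spectral_theorem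
    rw [Unitary.conjStarAlgAut_apply] at this
    exact this
  refine (connectionLaplacian_isHermitian K d).map_eigenvalues_of_conj_diagonal
    (P := cellPower d (U : Matrix K.faces K.faces ℝ))
    (Q := cellPower d (star (U : Matrix K.faces K.faces ℝ))) ?_ ?_
  · rw [← cellPower_diagonal, ← cellPower_mul, ← cellPower_mul, ← hA,
      connectionLaplacian_eq_cellPower]
  · rw [← cellPower_mul, Unitary.star_mul_self_of_mem U.2, cellPower_one]

/-! ### The density of states of a power as image of a product measure -/

/-- The density of states of the connection matrix on the faces. -/
def faceDensity : MeasureTheory.Measure ℝ :=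
  (Fintype.card K.faces : ℝ≥0∞)⁻¹ •
    ∑ s : K.faces, MeasureTheory.Measure.dirac ((connectionMatrix_isHermitian K).eigenvalues s)

theorem isProbabilityMeasure_faceDensity (hK : Nonempty K.faces) :
    MeasureTheory.IsProbabilityMeasure (faceDensity K) := by
  constructor
  have hc : (Fintype.card K.faces : ℝ≥0∞) ≠ 0 := Nat.cast_ne_zero.2 Fintype.card_ne_zero
  simp only [faceDensity, MeasureTheory.Measure.smul_apply,
    MeasureTheory.Measure.finsetSum_apply, MeasureTheory.measure_univ, Finset.sum_const,
    Finset.card_univ, nsmul_eq_mul, mul_one, smul_eq_mul]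
  exact ENNReal.inv_mul_cancel hc (ENNReal.natCast_ne_top _)

theorem densityOfStates_eq_sum :
    densityOfStates K d = (Fintype.card K.faces ^ d : ℝ≥0∞)⁻¹ • ∑ x : Fin d → K.faces,
      MeasureTheory.Measure.dirac (∏ k, (connectionMatrix_isHermitian K).eigenvalues (x k)) := by
  rw [densityOfStates, card_cell, Nat.cast_pow]
  congr 1
  -- A sum of Dirac measures depends only on the multiset of atoms.
  have h := congrArg (fun S : Multiset ℝ => (S.map MeasureTheory.Measure.dirac).sum)
    (eigenvalues_connectionLaplacian (d := d) K)
  simp only [Multiset.map_map] at h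
  exact h.trans (sum_cell fun x => MeasureTheory.Measure.dirac
    (∏ k, (connectionMatrix_isHermitian K).eigenvalues (x k)))

theorem densityOfStates_eq_map_pi (hK : Nonempty K.faces) :
    densityOfStates K d =
      (MeasureTheory.Measure.pi fun _ : Fin d => faceDensity K).map fun t => ∏ k, t k := by
  have := isProbabilityMeasure_faceDensity K hK
  -- The product of normalized counting measures is the normalized counting measure on tuples; both
  -- sides agree on boxes by expanding the product of sums.
  have hpi : (MeasureTheory.Measure.pi fun _ : Fin d => faceDensity K) =
      (Fintype.card K.faces ^ d : ℝ≥0∞)⁻¹ • ∑ x : Fin d → K.faces,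
        MeasureTheory.Measure.dirac
          fun k => (connectionMatrix_isHermitian K).eigenvalues (x k) := by
    refine MeasureTheory.Measure.pi_eq fun s hs => ?_
    simp only [faceDensity, MeasureTheory.Measure.smul_apply, MeasureTheory.Measure.finsetSum_apply,
      smul_eq_mul, MeasureTheory.Measure.dirac_apply' _ (MeasurableSet.univ_pi hs),
      MeasureTheory.Measure.dirac_apply' _ (hs _)]
    rw [Finset.prod_mul_distrib, Finset.prod_const, Finset.card_univ, Fintype.card_fin,
      Fintype.prod_sum, ENNReal.inv_pow]
    congr 1
    refine Finset.sum_congr rfl fun x _ => ?_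
    classical
    simp only [Set.indicator_apply, Pi.one_apply, Finset.prod_ite_zero, Finset.prod_const_one,
      Set.mem_pi, Set.mem_univ, Finset.mem_univ]
  have hm : Measurable fun t : Fin d → ℝ => ∏ k, t k := by fun_prop
  rw [hpi, densityOfStates_eq_sum, MeasureTheory.Measure.map_smul,
    MeasureTheory.Measure.map_finset_sum hm.aemeasurable]
  congr 1
  exact Finset.sum_congr rfl fun x _ => (MeasureTheory.Measure.map_dirac' hm _).symm

theorem densityOfStates_one : densityOfStates K 1 = faceDensity K := by
  rw [densityOfStates_eq_sum, faceDensity, pow_one]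
  congr 1
  exact Fintype.sum_equiv (Equiv.funUnique (Fin 1) K.faces) _ _ fun x => by simp

end Tensor

/-! ### The connection spectrum of a cycle -/

open Polynomial in
theorem Matrix.charpoly_blockDiagonal {m o R : Type} [Fintype m] [DecidableEq m] [Fintype o]
    [DecidableEq o] [CommRing R] (M : o → Matrix m m R) :
    (Matrix.blockDiagonal M).charpoly = ∏ k, (M k).charpoly := by
  have : (Matrix.blockDiagonal M).charmatrix =
      Matrix.blockDiagonal fun k => (M k).charmatrix := by
    ext ⟨i, k⟩ ⟨j, l⟩
    by_cases hkl : k = l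
    · subst hkl
      by_cases hij : i = j
      · subst hij
        simp [Matrix.charmatrix_apply_eq, Matrix.blockDiagonal_apply]
      · rw [Matrix.charmatrix_apply_ne _ _ _ (by simpa using hij), Matrix.blockDiagonal_apply,
          Matrix.blockDiagonal_apply, if_pos rfl, if_pos rfl, Matrix.charmatrix_apply_ne _ _ _ hij]
    · rw [Matrix.charmatrix_apply_ne _ _ _ (by simp [hkl]), Matrix.blockDiagonal_apply,
        Matrix.blockDiagonal_apply, if_neg hkl, if_neg hkl, map_zero, neg_zero]
  rw [Matrix.charpoly, this, Matrix.det_blockDiagonal]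
  rfl

/-! ### Fourier transform and block circulant matrices -/

/-- The Fourier transform on `ZMod N`, as a matrix. -/
def fourierMatrix (N : ℕ) [NeZero N] : Matrix (ZMod N) (ZMod N) ℂ :=
  fun j a => ZMod.stdAddChar (-(j * a))

/-- The inverse Fourier transform on `ZMod N`, as a matrix. -/
def inverseFourierMatrix (N : ℕ) [NeZero N] : Matrix (ZMod N) (ZMod N) ℂ :=
  fun a j => (N : ℂ)⁻¹ * ZMod.stdAddChar (a * j)

theorem inverseFourierMatrix_mul_fourierMatrix (N : ℕ) [NeZero N] :
    inverseFourierMatrix N * fourierMatrix N = 1 := by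
  ext a b
  have hN : (N : ℂ) ≠ 0 := NeZero.ne _
  rw [Matrix.mul_apply, Matrix.one_apply]
  have h1 : ∀ j : ZMod N, inverseFourierMatrix N a j * fourierMatrix N j b =
      (N : ℂ)⁻¹ * ZMod.stdAddChar (j * (a - b)) := by
    intro j
    rw [inverseFourierMatrix, fourierMatrix, mul_assoc, ← AddChar.map_add_eq_mul]
    congr 2
    ring
  simp_rw [h1]
  rw [← Finset.mul_sum, AddChar.sum_mulShift _ (ZMod.isPrimitive_stdAddChar N), ZMod.card]
  simp only [sub_eq_zero]
  split_ifs <;> simp [hN]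

/-- Block circulant matrices are block diagonalized by the Fourier transform. -/
theorem charpoly_of_blockCirculant {N : ℕ} [NeZero N] {m : Type} [Fintype m] [DecidableEq m]
    (κ : m → m → ZMod N → ℂ) :
    (Matrix.of fun x y : m × ZMod N => κ x.1 y.1 (x.2 - y.2)).charpoly =
      ∏ j : ZMod N, (Matrix.of fun s t => ∑ c, ZMod.stdAddChar (-(j * c)) * κ s t c).charpoly := by
  rw [← Matrix.charpoly_blockDiagonal]
  set B : Matrix (m × ZMod N) (m × ZMod N) ℂ := Matrix.of fun x y => κ x.1 y.1 (x.2 - y.2)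
  set D := Matrix.blockDiagonal fun j : ZMod N =>
    Matrix.of fun s t => ∑ c, ZMod.stdAddChar (-(j * c)) * κ s t c
  let F : Matrix (m × ZMod N) (m × ZMod N) ℂ :=
    Matrix.kroneckerMap (· * ·) (1 : Matrix m m ℂ) (fourierMatrix N)
  let F' : Matrix (m × ZMod N) (m × ZMod N) ℂ :=
    Matrix.kroneckerMap (· * ·) (1 : Matrix m m ℂ) (inverseFourierMatrix N)
  have hF : F' * F = 1 := by
    change Matrix.kroneckerMap _ _ _ * Matrix.kroneckerMap _ _ _ = 1
    rw [← Matrix.mul_kronecker_mul, one_mul, inverseFourierMatrix_mul_fourierMatrix,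
      Matrix.one_kronecker_one]
  have hFB : F * B = D * F := by
    ext ⟨s, j⟩ ⟨t, a⟩
    rw [Matrix.mul_apply, Matrix.mul_apply, Fintype.sum_prod_type, Fintype.sum_prod_type]
    simp only [F, B, D, Matrix.kroneckerMap_apply, Matrix.one_apply, Matrix.blockDiagonal_apply,
      Matrix.of_apply, ite_mul, one_mul, zero_mul, mul_ite, mul_zero]
    simp only [Finset.sum_ite_irrel, Finset.sum_const_zero, Finset.sum_ite_eq, Finset.mem_univ,
      if_true, Finset.sum_ite_eq']
    rw [Finset.sum_mul]
    -- The substitution `c = b - a` splits off the character value at `a` and leaves the Fourier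
    -- coefficient of the block.
    refine Fintype.sum_equiv (Equiv.subRight a) _ _ fun b => ?_
    simp only [Equiv.subRight_apply, fourierMatrix]
    rw [mul_right_comm, ← AddChar.map_add_eq_mul]
    congr 2
    ring
  have hB : B = F' * (D * F) := by
    rw [← hFB, ← mul_assoc, hF, one_mul]
  rw [hB, Matrix.charpoly_mul_comm, mul_assoc, mul_eq_one_comm.1 hF, mul_one]

/-- The differences `b - a` for which the faces of type `s` at `b` and of type `t` at `a` meet,
where `0` stands for vertices and `1` for edges. -/
def meetingDifferences (N : ℕ) : Fin 2 → Fin 2 → Finset (ZMod N) :=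
  !![{0}, {0, 1}; {0, -1}, {0, 1, -1}]

/-- The faces of a cycle, as vertices and edges. -/
def IsCyclicOrder.faceEquiv {V : Type} {K : PreAbstractSimplicialComplex V} {N : ℕ}
    {u : ℤ → V} (h : IsCyclicOrder K N u) (hN : 3 ≤ N) : Fin 2 × ZMod N ≃ K.faces :=
  Equiv.ofBijective (fun x => h.face (2 * (x.2.cast : ℤ) + (x.1 : ℕ))) (by
    have hN0 : NeZero N := ⟨by omega⟩
    constructor
    · rintro ⟨s, a⟩ ⟨t, b⟩ hxy
      rw [h.face_eq_iff (by omega) (by omega)] at hxy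
      dsimp only at hxy
      have h2 : (2 : ℤ) ∣ 2 * (a.cast : ℤ) + (s : ℕ) - (2 * (b.cast : ℤ) + (t : ℕ)) :=
        dvd_trans ⟨N, by push_cast; ring⟩ hxy
      have hst : s = t := by omega
      subst hst
      rw [add_sub_add_right_eq_sub, ← mul_sub, Nat.cast_mul] at hxy
      have h3 := Int.dvd_of_mul_dvd_mul_left (by norm_num) hxy
      rw [← ZMod.intCast_eq_intCast_iff_dvd_sub] at h3
      simpa using h3.symm
    · intro f
      obtain ⟨j, rfl⟩ := h.face_surjective f
      obtain ⟨a, ha⟩ := Int.even_or_odd' j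
      have key : ∀ s : ℕ, j = 2 * a + s →
          h.face (2 * (((a : ZMod N).cast : ℤ)) + s) = h.face j := by
        intro s hs
        rw [h.face_eq_iff (by omega) (by omega), hs, add_sub_add_right_eq_sub, ← mul_sub,
          Nat.cast_mul]
        refine mul_dvd_mul_left _ ?_
        rw [← ZMod.intCast_eq_intCast_iff_dvd_sub]
        simp
      rcases ha with ha | ha
      · exact ⟨(0, (a : ZMod N)), key 0 (by simpa using ha)⟩
      · exact ⟨(1, (a : ZMod N)), key 1 (by simpa using ha)⟩)

theorem IsCyclicOrder.connectionMatrix_faceEquiv {V : Type} {K : PreAbstractSimplicialComplex V}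
    {N : ℕ} {u : ℤ → V} (h : IsCyclicOrder K N u) (hN : 3 ≤ N) (x y : Fin 2 × ZMod N) :
    connectionMatrix K (h.faceEquiv hN x) (h.faceEquiv hN y) =
      if x.2 - y.2 ∈ meetingDifferences N x.1 y.1 then 1 else 0 := by
  have hN0 : NeZero N := ⟨by omega⟩
  have hu : ∀ p q : ℤ, u p = u q ↔ (p : ZMod N) = q := by
    intro p q
    rw [h.eq_iff, ← ZMod.intCast_eq_intCast_iff_dvd_sub, eq_comm]
  obtain ⟨s, b⟩ := x
  obtain ⟨t, a⟩ := y
  rw [connectionMatrix]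
  classical
  refine if_congr ?_ rfl rfl
  change (∃ p, p ∈ labelledFace u (2 * (b.cast : ℤ) + (s : ℕ)) ∧
    p ∈ labelledFace u (2 * (a.cast : ℤ) + (t : ℕ))) ↔ _
  fin_cases s <;> fin_cases t <;>
    simp only [Fin.zero_eta, Fin.mk_one, Fin.isValue, Nat.cast_zero,
      Nat.cast_one, add_zero, mem_labelledFace_two_mul, mem_labelledFace_two_mul_add_one,
      or_and_right, exists_or, exists_eq_left, hu, Int.cast_add, Int.cast_one,
      ZMod.intCast_cast, ZMod.cast_id', id, meetingDifferences, Matrix.of_apply, Matrix.cons_val_zero,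
      Matrix.cons_val_one, Finset.mem_insert, Finset.mem_singleton] <;> grind

theorem stdAddChar_add_stdAddChar_neg {N : ℕ} [NeZero N] (i : ℕ) :
    ZMod.stdAddChar (i : ZMod N) + ZMod.stdAddChar (-(i : ZMod N)) =
      ((2 * Real.cos (2 * Real.pi * i / N) : ℝ) : ℂ) := by
  have h1 := ZMod.stdAddChar_coe (N := N) i
  have h2 := ZMod.stdAddChar_coe (N := N) (-i)
  push_cast at h1 h2 ⊢
  rw [h1, h2, Complex.cos]
  field_simp

/-- With `z` the character value at `i` and `z'` its inverse, the block is `!![1, 1 + z'; 1 + z, 1 +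
z + z']`, of determinant `-z z' = -1`. The bound `3 ≤ N` makes `0`, `1` and `-1` distinct, so the
sums have the expected number of terms. -/
theorem charpoly_fourierBlock {N : ℕ} [NeZero N] (hN : 3 ≤ N) (i : ℕ) :
    (Matrix.of fun s t => ∑ c : ZMod N, ZMod.stdAddChar (-((i : ZMod N) * c)) *
      (if c ∈ meetingDifferences N s t then (1 : ℂ) else 0)).charpoly =
      Polynomial.X ^ 2 -
        Polynomial.C ((2 + 2 * Real.cos (2 * Real.pi * i / N) : ℝ) : ℂ) * Polynomial.X - 1 := by
  have h10 : (1 : ZMod N) ≠ 0 := by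
    have := ZMod.natCast_eq_zero_iff 1 N
    intro h
    have := Nat.le_of_dvd (by norm_num) (this.1 (by exact_mod_cast h))
    omega
  have h11 : (1 : ZMod N) ≠ -1 := by
    have := ZMod.natCast_eq_zero_iff 2 N
    intro h
    have h2 : ((2 : ℕ) : ZMod N) = 0 := by push_cast; linear_combination h
    have := Nat.le_of_dvd (by norm_num) (this.1 h2)
    omega
  have h10' : (-1 : ZMod N) ≠ 0 := neg_ne_zero.2 h10
  have hval : ∀ s t, ∑ c : ZMod N, ZMod.stdAddChar (-((i : ZMod N) * c)) *
      (if c ∈ meetingDifferences N s t then (1 : ℂ) else 0) =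
      ∑ c ∈ meetingDifferences N s t, ZMod.stdAddChar (-((i : ZMod N) * c)) := by
    intro s t
    simp
  have hmul : ZMod.stdAddChar (i : ZMod N) * ZMod.stdAddChar (-(i : ZMod N)) = 1 := by
    rw [← AddChar.map_add_eq_mul, add_neg_cancel, AddChar.map_zero_eq_one]
  have hadd := stdAddChar_add_stdAddChar_neg (N := N) i
  simp only [hval]
  rw [Matrix.charpoly_fin_two, Matrix.trace_fin_two, Matrix.det_fin_two]
  simp only [Matrix.of_apply, meetingDifferences, Matrix.cons_val_zero, Matrix.cons_val_one,
    Fin.isValue]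
  rw [Finset.sum_insert (by simp [h10.symm, h10'.symm]), Finset.sum_pair h11,
    Finset.sum_pair h10.symm, Finset.sum_pair h10'.symm]
  simp only [Finset.sum_singleton, mul_zero, neg_zero, AddChar.map_zero_eq_one, mul_one, mul_neg,
    neg_neg]
  set z := ZMod.stdAddChar (i : ZMod N)
  set z' := ZMod.stdAddChar (-(i : ZMod N))
  have htr : 1 + (1 + (z' + z)) = ((2 + 2 * Real.cos (2 * Real.pi * i / N) : ℝ) : ℂ) := by
    push_cast at hadd ⊢
    linear_combination hadd
  have hdet : 1 * (1 + (z' + z)) - (1 + z') * (1 + z) = -1 := by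
    linear_combination -hmul
  rw [htr, hdet, map_neg, map_one, sub_eq_add_neg _ (1 : Polynomial ℂ)]

/-! ### The eigenvalues of a cycle as values on a grid -/

/-- The eigenvalues of the connection Laplacians of cycles: those of the two bands, as functions on
`[0, 1 / 2)` and on `[1 / 2, 1)`. -/
def dispersion (x : ℝ) : ℝ :=
  if x < 1 / 2 then
    (1 + Real.cos (4 * Real.pi * x)) + √((1 + Real.cos (4 * Real.pi * x)) ^ 2 + 1)
  else (1 + Real.cos (4 * Real.pi * x)) - √((1 + Real.cos (4 * Real.pi * x)) ^ 2 + 1)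

/-- The first half of the grid gives the upper band; the second half is moved by `1 / 2`, a full
period of `cos (4πx)`, so it gives the lower band at the same frequencies. -/
theorem prod_range_two_mul_dispersion {M : Type} [CommMonoid M] {N : ℕ} (hN : N ≠ 0) (g : ℝ → M) :
    ∏ j ∈ Finset.range (2 * N), g (dispersion (j / (2 * N : ℕ))) =
      ∏ i ∈ Finset.range N,
        (g ((1 + Real.cos (2 * Real.pi * i / N)) + √((1 + Real.cos (2 * Real.pi * i / N)) ^ 2 + 1)) *
        g ((1 + Real.cos (2 * Real.pi * i / N)) -
          √((1 + Real.cos (2 * Real.pi * i / N)) ^ 2 + 1))) := by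
  have hN' : (0 : ℝ) < N := by positivity
  rw [two_mul, Finset.prod_range_add, ← Finset.prod_mul_distrib]
  refine Finset.prod_congr rfl fun i hi => ?_
  have hi' : (i : ℝ) < N := by exact_mod_cast Finset.mem_range.1 hi
  have h1 : 4 * Real.pi * (i / (N + N : ℕ)) = 2 * Real.pi * i / N := by
    push_cast
    field_simp
    ring
  have h2 : 4 * Real.pi * ((N + i : ℕ) / (N + N : ℕ)) = 2 * Real.pi * i / N + 2 * Real.pi := by
    push_cast
    field_simp
    ring
  rw [dispersion, if_pos, dispersion, if_neg, h1, h2, Real.cos_add_two_pi]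
  · push_cast
    rw [not_lt, div_le_div_iff₀ (by norm_num) (by positivity)]
    linarith [Nat.cast_nonneg (α := ℝ) i]
  · push_cast
    rw [div_lt_div_iff₀ (by positivity) (by norm_num)]
    linarith

theorem prod_zmod {M : Type} [CommMonoid M] {N : ℕ} [NeZero N] (g : ZMod N → M) :
    ∏ j : ZMod N, g j = ∏ i ∈ Finset.range N, g (i : ZMod N) := by
  refine Finset.prod_nbij' (fun j => j.val) (fun i => (i : ZMod N)) ?_ ?_ ?_ ?_ ?_
  · intro j _
    exact Finset.mem_range.2 j.val_lt
  · simp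
  · simp
  · intro i hi
    exact ZMod.val_cast_of_lt (Finset.mem_range.1 hi)
  · simp

theorem IsCyclicOrder.charpoly_connectionMatrix {V : Type} [Finite V]
    {K : PreAbstractSimplicialComplex V} {N : ℕ} {u : ℤ → V} (h : IsCyclicOrder K N u)
    (hN : 3 ≤ N) :
    (connectionMatrix K).charpoly =
      ∏ j ∈ Finset.range (2 * N),
        (Polynomial.X - Polynomial.C (dispersion (j / (2 * N : ℕ)))) := by
  have hN0 : NeZero N := ⟨by omega⟩
  -- The characters are complex valued, so the real characteristic polynomial is computed over `ℂ`.
  refine Polynomial.map_injective Complex.ofRealHom Complex.ofReal_injective ?_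
  rw [prod_range_two_mul_dispersion (by omega) fun t => Polynomial.X - Polynomial.C t,
    ← Matrix.charpoly_map, ← Matrix.charpoly_reindex (h.faceEquiv hN).symm]
  have hB : Matrix.reindex (h.faceEquiv hN).symm (h.faceEquiv hN).symm
      ((connectionMatrix K).map Complex.ofRealHom) =
      Matrix.of fun x y : Fin 2 × ZMod N =>
        if x.2 - y.2 ∈ meetingDifferences N x.1 y.1 then (1 : ℂ) else 0 := by
    ext x y
    rw [Matrix.reindex_apply, Matrix.submatrix_apply, Matrix.map_apply, Equiv.symm_symm,
      h.connectionMatrix_faceEquiv hN]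
    simp only [Matrix.of_apply]
    split_ifs <;> simp
  change (Matrix.reindex _ _ ((connectionMatrix K).map Complex.ofRealHom)).charpoly = _
  rw [hB, charpoly_of_blockCirculant
    (fun s t c => if c ∈ meetingDifferences N s t then (1 : ℂ) else 0), prod_zmod,
    Polynomial.map_prod]
  refine Finset.prod_congr rfl fun i _ => ?_
  rw [charpoly_fourierBlock hN]
  set r := Real.cos (2 * Real.pi * i / N)
  have hs : √((1 + r) ^ 2 + 1) ^ 2 = (1 + r) ^ 2 + 1 := Real.sq_sqrt (by positivity)
  have hreal : (Polynomial.X - Polynomial.C ((1 + r) + √((1 + r) ^ 2 + 1))) *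
      (Polynomial.X - Polynomial.C ((1 + r) - √((1 + r) ^ 2 + 1))) =
      (Polynomial.X ^ 2 - Polynomial.C (2 + 2 * r) * Polynomial.X - 1 : Polynomial ℝ) := by
    have h1 : Polynomial.C (√((1 + r) ^ 2 + 1)) ^ 2 = Polynomial.C ((1 + r) ^ 2 + 1) := by
      rw [← map_pow, hs]
    simp only [map_add, map_sub, map_mul, map_pow, map_one, Polynomial.C_ofNat] at h1 ⊢
    linear_combination -h1
  rw [hreal]
  simp

theorem IsCyclicOrder.map_eigenvalues_connectionMatrix {V : Type} [Finite V]
    {K : PreAbstractSimplicialComplex V} {N : ℕ} {u : ℤ → V} (h : IsCyclicOrder K N u)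
    (hN : 3 ≤ N) :
    Finset.univ.val.map (connectionMatrix_isHermitian K).eigenvalues =
      (Finset.range (2 * N)).val.map fun j : ℕ => dispersion (j / (2 * N : ℕ)) := by
  rw [Matrix.IsHermitian.map_eigenvalues, h.charpoly_connectionMatrix hN,
    ← Polynomial.roots_multiset_prod_X_sub_C
      ((Finset.range (2 * N)).val.map fun j : ℕ => dispersion (j / (2 * N : ℕ))),
    Multiset.map_map]
  rfl

/-- The density of states of the connection matrix of a cycle. -/
theorem IsCyclicOrder.faceDensity_eq {V : Type} [Finite V]
    {K : PreAbstractSimplicialComplex V} {N : ℕ} {u : ℤ → V} (h : IsCyclicOrder K N u)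
    (hN : 3 ≤ N) :
    faceDensity K = ((2 * N : ℕ) : ℝ≥0∞)⁻¹ • ∑ j ∈ Finset.range (2 * N),
      MeasureTheory.Measure.dirac (dispersion (j / (2 * N : ℕ))) := by
  rw [faceDensity, ← Nat.card_eq_fintype_card, h.natCard_faces hN]
  congr 1
  have h1 := congrArg (fun S : Multiset ℝ => (S.map MeasureTheory.Measure.dirac).sum)
    (h.map_eigenvalues_connectionMatrix hN)
  simp only [Multiset.map_map] at h1
  exact h1

/-! ### The limiting density of states -/

/-- For `c` in `[0, 2]` the smaller absolute value `√(c ^ 2 + 1) - c` is at least `√5 - 2`. The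
rational bound `4 / 17` suffices, since `2 * c * (4 / 17) + (4 / 17) ^ 2 ≤ 288 / 289 < 1`. -/
theorem four_div_seventeen_le_abs_dispersion (x : ℝ) : 4 / 17 ≤ |dispersion x| := by
  have h1 := Real.neg_one_le_cos (4 * Real.pi * x)
  have h2 := Real.cos_le_one (4 * Real.pi * x)
  rw [dispersion]
  set c := 1 + Real.cos (4 * Real.pi * x)
  have h3 : 0 ≤ c := by simp only [c]; linarith
  have h4 : c ≤ 2 := by simp only [c]; linarith
  have h5 : c + 4 / 17 ≤ √(c ^ 2 + 1) := Real.le_sqrt_of_sq_le (by nlinarith)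
  split_ifs
  · exact le_trans (by linarith) (le_abs_self _)
  · exact le_trans (by linarith) (neg_le_abs _)

theorem dispersion_ne_zero (x : ℝ) : dispersion x ≠ 0 := by
  have := four_div_seventeen_le_abs_dispersion x
  intro h
  rw [h, abs_zero] at this
  norm_num at this

theorem four_div_seventeen_pow_le_abs_prod_dispersion {d : ℕ} (x : Fin d → ℝ) :
    (4 / 17) ^ d ≤ |∏ k, dispersion (x k)| := by
  rw [Finset.abs_prod]
  calc ((4 / 17) ^ d : ℝ) = ∏ _k : Fin d, (4 / 17 : ℝ) := by
        rw [Finset.prod_const, Finset.card_univ, Fintype.card_fin]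
    _ ≤ _ := Finset.prod_le_prod (fun _ _ => by norm_num)
        fun k _ => four_div_seventeen_le_abs_dispersion (x k)

theorem one_div_pow_lt {d : ℕ} (hd : 1 ≤ d) : (1 / 5 ^ d : ℝ) < (4 / 17) ^ d := by
  rw [← one_div_pow]
  exact pow_lt_pow_left₀ (by norm_num) (by norm_num) (by omega)

theorem measurable_dispersion : Measurable dispersion := by
  unfold dispersion
  exact Measurable.ite measurableSet_Iio (by fun_prop) (by fun_prop)

/-! ### Null sets under the dispersion function -/

/-- A function with nonzero strict derivatives outside of a countable set pulls back null sets to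
null sets. -/
theorem volume_preimage_eq_zero_of_hasStrictDerivAt {f : ℝ → ℝ} {E : Set ℝ} (hE : E.Countable)
    (hf : ∀ x ∉ E, ∃ f', f' ≠ 0 ∧ HasStrictDerivAt f f' x) {s : Set ℝ}
    (hs : MeasureTheory.volume s = 0) : MeasureTheory.volume (f ⁻¹' s) = 0 := by
  have hdiff : MeasureTheory.volume (f ⁻¹' s \ E) = 0 := by
    refine MeasureTheory.measure_null_of_locally_null _ fun x hx => ?_
    obtain ⟨f', hf', hd⟩ := hf x hx.2
    -- Half the derivative as error bound makes `f` expand distances by at least `|f'| / 2` near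
    -- `x`. So `f` is injective there with Lipschitz inverse, and a Lipschitz map does not increase
    -- null sets, Lebesgue measure being one-dimensional Hausdorff measure.
    have hlo := hd.hasStrictFDerivAt.isLittleO.def (c := |f'| / 2) (by positivity)
    rw [nhds_prod_eq] at hlo
    obtain ⟨U, hU, hUs⟩ := Filter.mem_prod_same_iff.1 hlo
    have hanti : ∀ y ∈ U, ∀ z ∈ U, |f'| / 2 * |y - z| ≤ |f y - f z| := by
      intro y hy z hz
      have := hUs (Set.mk_mem_prod hy hz)
      simp only [Set.mem_ofPred_eq, Real.norm_eq_abs,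
        ContinuousLinearMap.toSpanSingleton_apply, smul_eq_mul] at this
      have h1 := abs_sub_abs_le_abs_sub ((y - z) * f') (f y - f z)
      rw [abs_sub_comm ((y - z) * f'), abs_mul] at h1
      linarith
    have hpos : 0 < |f'| / 2 := by positivity
    have hinj : Set.InjOn f U := by
      intro y hy z hz hyz
      have := hanti y hy z hz
      rw [hyz, sub_self, abs_zero] at this
      have h1 : |y - z| ≤ 0 := nonpos_of_mul_nonpos_right this hpos
      exact sub_eq_zero.1 (abs_nonpos_iff.1 h1)
    have hlip : LipschitzOnWith (Real.toNNReal (|f'| / 2)⁻¹) (Function.invFunOn f U) (f '' U) := by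
      refine LipschitzOnWith.of_dist_le_mul ?_
      rintro _ ⟨y, hy, rfl⟩ _ ⟨z, hz, rfl⟩
      rw [hinj.leftInvOn_invFunOn hy, hinj.leftInvOn_invFunOn hz, Real.dist_eq, Real.dist_eq,
        Real.coe_toNNReal _ (by positivity), ← div_eq_inv_mul, le_div_iff₀ hpos, mul_comm]
      exact hanti y hy z hz
    refine ⟨U ∩ f ⁻¹' s, ?_, ?_⟩
    · refine Filter.inter_mem (mem_nhdsWithin_of_mem_nhds hU) ?_
      exact Filter.mem_of_superset self_mem_nhdsWithin Set.sdiff_subset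
    · have hsub : U ∩ f ⁻¹' s ⊆ Function.invFunOn f U '' (f '' U ∩ s) := fun y hy =>
        ⟨f y, ⟨Set.mem_image_of_mem f hy.1, hy.2⟩, hinj.leftInvOn_invFunOn hy.1⟩
      refine MeasureTheory.measure_mono_null hsub ?_
      have h1 := (hlip.mono (Set.inter_subset_left (t := s))).hausdorffMeasure_image_le
        (zero_le_one' ℝ)
      rw [MeasureTheory.hausdorffMeasure_real] at h1
      refine le_antisymm (h1.trans (le_of_eq ?_)) zero_le
      rw [MeasureTheory.measure_mono_null Set.inter_subset_right hs, mul_zero]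
  refine MeasureTheory.measure_mono_null (t := (f ⁻¹' s \ E) ∪ E) ?_ ?_
  · intro x hx
    by_cases hxE : x ∈ E
    · exact Or.inr hxE
    · exact Or.inl ⟨hx, hxE⟩
  · exact MeasureTheory.measure_union_null hdiff (hE.measure_zero _)

/-- The derivative is `c' * (1 ± c / √(c ^ 2 + 1))`; the bracket is positive because the quotient
has absolute value below one, so only zeros of `c'` could spoil it. -/
theorem hasStrictDerivAt_dispersion {x : ℝ} (h0 : Real.sin (4 * Real.pi * x) ≠ 0)
    (h1 : x ≠ 1 / 2) : ∃ f', f' ≠ 0 ∧ HasStrictDerivAt dispersion f' x := by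
  have hc : HasStrictDerivAt (fun x : ℝ => 1 + Real.cos (4 * Real.pi * x))
      (-Real.sin (4 * Real.pi * x) * (4 * Real.pi)) x := by
    have := ((hasStrictDerivAt_id x).const_mul (4 * Real.pi)).cos.const_add 1
    simpa using this
  set c := 1 + Real.cos (4 * Real.pi * x) with hcdef
  have hpos : 0 < c ^ 2 + 1 := by positivity
  have hs : HasStrictDerivAt (fun x : ℝ => √((1 + Real.cos (4 * Real.pi * x)) ^ 2 + 1))
      (c / √(c ^ 2 + 1) * (-Real.sin (4 * Real.pi * x) * (4 * Real.pi))) x := by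
    have := ((hc.pow 2).add_const 1).sqrt hpos.ne'
    refine this.congr_deriv ?_
    simp only [Pi.pow_apply, ← hcdef]
    field_simp
    simp
  have hlt : |c / √(c ^ 2 + 1)| < 1 := by
    rw [abs_div, abs_of_pos (Real.sqrt_pos.2 hpos), div_lt_one (Real.sqrt_pos.2 hpos)]
    exact Real.lt_sqrt_of_sq_lt (by rw [sq_abs]; linarith)
  obtain ⟨hl1, hl2⟩ := abs_lt.1 hlt
  have hne : -Real.sin (4 * Real.pi * x) * (4 * Real.pi) ≠ 0 :=
    mul_ne_zero (neg_ne_zero.2 h0) (by positivity)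
  rcases lt_or_gt_of_ne h1 with h | h
  · refine ⟨_, ?_, (hc.add hs).congr_of_eventuallyEq ?_⟩
    · rw [← one_add_mul]
      exact mul_ne_zero (by linarith) hne
    · filter_upwards [eventually_lt_nhds h] with y hy
      exact (if_pos hy).symm
  · refine ⟨_, ?_, (hc.sub hs).congr_of_eventuallyEq ?_⟩
    · rw [← one_sub_mul]
      exact mul_ne_zero (by linarith) hne
    · filter_upwards [eventually_gt_nhds h] with y hy
      exact (if_neg (not_lt.2 (le_of_lt hy))).symm

theorem volume_preimage_dispersion {s : Set ℝ} (hs : MeasureTheory.volume s = 0) :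
    MeasureTheory.volume (dispersion ⁻¹' s) = 0 := by
  refine volume_preimage_eq_zero_of_hasStrictDerivAt
    -- The zeros of `sin (4πx)` are the multiples of `1 / 4`. The jump point `1 / 2` is among them
    -- and is inserted only to have it at hand.
    (E := insert (1 / 2) (Set.range fun n : ℤ => (n : ℝ) / 4))
    ((Set.countable_range _).insert _) (fun x hx => ?_) hs
  rw [Set.mem_insert_iff, not_or] at hx
  refine hasStrictDerivAt_dispersion (fun h => hx.2 ?_) hx.1
  obtain ⟨n, hn⟩ := Real.sin_eq_zero_iff.1 h
  refine ⟨n, ?_⟩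
  have := Real.pi_ne_zero
  field_simp at hn
  simp only
  linarith

/-! ### Uniform distributions on grids and their limit -/

/-- The grid point below `x` in the grid of mesh `1 / M`. -/
def gridFloor (M : ℕ) (x : ℝ) : ℝ := (⌊M * x⌋ : ℝ) / M

theorem measurable_gridFloor (M : ℕ) : Measurable (gridFloor M) := by
  unfold gridFloor
  fun_prop

/-- The uniform distribution on `[0, 1)`. -/
def unitMeasure : MeasureTheory.Measure ℝ := MeasureTheory.volume.restrict (Set.Ico 0 1)

instance : MeasureTheory.IsProbabilityMeasure unitMeasure :=
  ⟨by simp [unitMeasure]⟩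

/-- Rounding down is constant on each of the `M` grid intervals, which have mass `1 / M`. All cycles
are thereby modelled on one probability space, and weak convergence follows from pointwise
convergence. -/
theorem map_gridFloor_unitMeasure {M : ℕ} (hM : 0 < M) :
    unitMeasure.map (gridFloor M) =
      (M : ℝ≥0∞)⁻¹ • ∑ j ∈ Finset.range M, MeasureTheory.Measure.dirac ((j : ℝ) / M) := by
  have hM' : (0 : ℝ) < M := by exact_mod_cast hM
  have hmem : ∀ (j : ℕ) (x : ℝ), x ∈ Set.Ico ((j : ℝ) / M) ((j + 1 : ℝ) / M) ↔
      ⌊(M : ℝ) * x⌋ = (j : ℤ) := by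
    intro j x
    rw [Int.floor_eq_iff, Set.mem_Ico, div_le_iff₀ hM', lt_div_iff₀ hM', mul_comm x]
    simp
  have hunion : Set.Ico (0 : ℝ) 1 =
      ⋃ j ∈ Finset.range M, Set.Ico ((j : ℝ) / M) ((j + 1 : ℝ) / M) := by
    ext x
    simp only [Set.mem_iUnion, hmem, Finset.mem_range, exists_prop, Set.mem_Ico]
    constructor
    · rintro ⟨h0, h1⟩
      refine ⟨⌊(M : ℝ) * x⌋.toNat, ?_, ?_⟩
      · have h2 : ⌊(M : ℝ) * x⌋ < M := by
          rw [Int.floor_lt]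
          push_cast
          nlinarith
        omega
      · rw [Int.toNat_of_nonneg (Int.floor_nonneg.2 (by positivity))]
    · rintro ⟨j, hj, hx⟩
      rw [Int.floor_eq_iff] at hx
      have hj' : (j : ℝ) + 1 ≤ M := by exact_mod_cast hj
      have hj0 : (0 : ℝ) ≤ j := Nat.cast_nonneg j
      push_cast at hx
      constructor
      · exact nonneg_of_mul_nonneg_right (hj0.trans hx.1) hM'
      · by_contra h
        nlinarith
  rw [unitMeasure, hunion, MeasureTheory.Measure.restrict_biUnion_finset,
    MeasureTheory.Measure.sum_fintype,
    MeasureTheory.Measure.map_finset_sum (measurable_gridFloor M).aemeasurable, Finset.smul_sum,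
    ← Finset.sum_coe_sort (Finset.range M)]
  · refine Finset.sum_congr rfl fun j _ => ?_
    have h1 : gridFloor M =ᵐ[MeasureTheory.volume.restrict
        (Set.Ico ((j : ℕ) / M : ℝ) (((j : ℕ) + 1 : ℝ) / M))] fun _ => (j : ℕ) / M := by
      filter_upwards [MeasureTheory.ae_restrict_mem measurableSet_Ico] with x hx
      rw [gridFloor, (hmem j x).1 hx, Int.cast_natCast]
    rw [MeasureTheory.Measure.map_congr h1, MeasureTheory.Measure.map_const]
    congr 1
    rw [MeasureTheory.Measure.restrict_apply_univ, Real.volume_Ico, ← sub_div,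
      add_sub_cancel_left, one_div, ENNReal.ofReal_inv_of_pos hM', ENNReal.ofReal_natCast]
  · intro i _ j _ hij
    refine Set.disjoint_left.2 fun x hi hj => hij ?_
    rw [hmem] at hi hj
    exact_mod_cast hi.symm.trans hj
  · exact fun _ => measurableSet_Ico

theorem IsCyclicOrder.faceDensity_eq_map {V : Type} [Finite V]
    {K : PreAbstractSimplicialComplex V} {N : ℕ} {u : ℤ → V} (h : IsCyclicOrder K N u)
    (hN : 3 ≤ N) :
    faceDensity K = unitMeasure.map fun x => dispersion (gridFloor (2 * N) x) := by
  have h1 := MeasureTheory.Measure.map_map (μ := unitMeasure) measurable_dispersion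
    (measurable_gridFloor (2 * N))
  rw [map_gridFloor_unitMeasure (by omega), MeasureTheory.Measure.map_smul,
    MeasureTheory.Measure.map_finset_sum measurable_dispersion.aemeasurable] at h1
  simp only [MeasureTheory.Measure.map_dirac' measurable_dispersion] at h1
  rw [h.faceDensity_eq hN, h1]
  rfl

theorem tendsto_gridFloor (x : ℝ) :
    Filter.Tendsto (fun M : ℕ => gridFloor M x) Filter.atTop (nhds x) := by
  have hlim : Filter.Tendsto (fun M : ℕ => x - 1 / (M : ℝ)) Filter.atTop (nhds x) := by
    simpa using tendsto_one_div_atTop_nhds_zero_nat.const_sub x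
  refine tendsto_of_tendsto_of_tendsto_of_le_of_le' hlim tendsto_const_nhds ?_ ?_
  · filter_upwards [Filter.eventually_gt_atTop 0] with M hM
    have hM' : (0 : ℝ) < M := by exact_mod_cast hM
    rw [gridFloor, le_div_iff₀ hM', sub_mul, one_div_mul_cancel hM'.ne', mul_comm x]
    exact (Int.sub_one_lt_floor _).le
  · filter_upwards [Filter.eventually_gt_atTop 0] with M hM
    have hM' : (0 : ℝ) < M := by exact_mod_cast hM
    rw [gridFloor, div_le_iff₀ hM', mul_comm x]
    exact Int.floor_le _

theorem tendsto_dispersion_gridFloor (x : ℝ) :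
    Filter.Tendsto (fun N : ℕ => dispersion (gridFloor (2 * N) x)) Filter.atTop
      (nhds (dispersion x)) := by
  have h2 : Filter.Tendsto (fun N : ℕ => 2 * N) Filter.atTop Filter.atTop :=
    Filter.tendsto_id.const_mul_atTop' (by norm_num)
  by_cases hx : x = 1 / 2
  -- At the jump, continuity is not available, but a grid with an even number of points contains `1
  -- / 2`, so rounding fixes it and the sequence is eventually constant.
  · refine tendsto_const_nhds.congr' ?_
    filter_upwards [Filter.eventually_gt_atTop 0] with N hN
    have hN' : (N : ℝ) ≠ 0 := by positivity
    have : ((2 * N : ℕ) : ℝ) * x = ((N : ℤ) : ℝ) := by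
      rw [hx]
      push_cast
      ring
    rw [gridFloor, this, Int.floor_intCast, hx]
    congr 1
    push_cast
    field_simp
  · have hc : ContinuousAt dispersion x := by
      rcases lt_or_gt_of_ne hx with h | h
      · refine ContinuousAt.congr (f := fun x => (1 + Real.cos (4 * Real.pi * x)) +
          √((1 + Real.cos (4 * Real.pi * x)) ^ 2 + 1)) (by fun_prop) ?_
        filter_upwards [eventually_lt_nhds h] with y hy
        exact (if_pos hy).symm
      · refine ContinuousAt.congr (f := fun x => (1 + Real.cos (4 * Real.pi * x)) -
          √((1 + Real.cos (4 * Real.pi * x)) ^ 2 + 1)) (by fun_prop) ?_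
        filter_upwards [eventually_gt_nhds h] with y hy
        exact (if_neg (not_lt.2 (le_of_lt hy))).symm
    exact hc.tendsto.comp ((tendsto_gridFloor x).comp h2)

/-! ### Weak convergence, absolute continuity and gap of the limit -/

/-- The limiting density of states. -/
def latticeDensity (d : ℕ) : MeasureTheory.Measure ℝ :=
  (MeasureTheory.Measure.pi fun _ : Fin d => unitMeasure).map fun x => ∏ k, dispersion (x k)

theorem measurable_prod_dispersion (d : ℕ) :
    Measurable fun x : Fin d → ℝ => ∏ k, dispersion (x k) := by
  have := measurable_dispersion
  fun_prop

instance (d : ℕ) : MeasureTheory.IsProbabilityMeasure (latticeDensity d) :=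
  MeasureTheory.Measure.isProbabilityMeasure_map (measurable_prod_dispersion d).aemeasurable

theorem IsCyclicOrder.densityOfStates_eq_map {V : Type} [Finite V]
    {K : PreAbstractSimplicialComplex V} {N : ℕ} {u : ℤ → V} (h : IsCyclicOrder K N u)
    (hN : 3 ≤ N) (d : ℕ) :
    densityOfStates K d = (MeasureTheory.Measure.pi fun _ : Fin d => unitMeasure).map
      fun x => ∏ k, dispersion (gridFloor (2 * N) (x k)) := by
  have hm : Measurable fun x => dispersion (gridFloor (2 * N) x) :=
    measurable_dispersion.comp (measurable_gridFloor _)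
  have : MeasureTheory.IsProbabilityMeasure
      (unitMeasure.map fun x => dispersion (gridFloor (2 * N) x)) :=
    MeasureTheory.Measure.isProbabilityMeasure_map hm.aemeasurable
  have hpi : Measurable fun (x : Fin d → ℝ) k => dispersion (gridFloor (2 * N) (x k)) :=
    measurable_pi_lambda _ fun k => hm.comp (measurable_pi_apply k)
  rw [densityOfStates_eq_map_pi K ⟨h.face 0⟩, h.faceDensity_eq_map hN,
    ← MeasureTheory.Measure.pi_map_pi fun _ => hm.aemeasurable,
    MeasureTheory.Measure.map_map (by fun_prop) hpi]
  rfl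

/-- The densities of states of powers of cycles converge weakly when the lengths of the cycles tend
to infinity. -/
theorem tendsto_integral_densityOfStates {V : ℕ → Type} [∀ m, Finite (V m)]
    {K : (m : ℕ) → PreAbstractSimplicialComplex (V m)} {N : ℕ → ℕ} {u : (m : ℕ) → ℤ → V m}
    (h : ∀ m, IsCyclicOrder (K m) (N m) (u m)) (hN3 : ∀ m, 3 ≤ N m)
    (hN : Filter.Tendsto N Filter.atTop Filter.atTop) (d : ℕ)
    (f : BoundedContinuousFunction ℝ ℝ) :
    Filter.Tendsto (fun m => ∫ t, f t ∂(densityOfStates (K m) d)) Filter.atTop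
      (nhds (∫ t, f t ∂(latticeDensity d))) := by
  have hm : ∀ m, Measurable fun x : Fin d → ℝ => ∏ k, dispersion (gridFloor (2 * N m) (x k)) := by
    exact fun m => Finset.measurable_prod _ fun k _ => measurable_dispersion.comp
      ((measurable_gridFloor _).comp (measurable_pi_apply k))
  have hf : Measurable f := f.continuous.measurable
  have h1 : ∀ m, ∫ t, f t ∂(densityOfStates (K m) d) =
      ∫ x, f (∏ k, dispersion (gridFloor (2 * N m) (x k)))
        ∂(MeasureTheory.Measure.pi fun _ : Fin d => unitMeasure) := by
    intro m
    rw [(h m).densityOfStates_eq_map (hN3 m),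
      MeasureTheory.integral_map (hm m).aemeasurable hf.aestronglyMeasurable]
  rw [latticeDensity, MeasureTheory.integral_map (measurable_prod_dispersion d).aemeasurable
    hf.aestronglyMeasurable]
  simp only [h1]
  -- The test function is bounded, so its norm is an integrable majorant on the probability space.
  refine MeasureTheory.tendsto_integral_of_dominated_convergence (fun _ => ‖f‖) ?_ ?_ ?_ ?_
  · exact fun m => (hf.comp (hm m)).aestronglyMeasurable
  · exact MeasureTheory.integrable_const _
  · exact fun m => Filter.Eventually.of_forall fun x => f.norm_coe_le_norm _
  · refine Filter.Eventually.of_forall fun x => (f.continuous.tendsto _).comp ?_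
    exact tendsto_finsetProd _ fun k _ => (tendsto_dispersion_gridFloor (x k)).comp hN

/-- By Fubini it suffices to fix all coordinates but one. The fixed factors form a nonzero constant,
scaling by which preserves null sets, and `dispersion` pulls null sets back to null sets. -/
theorem latticeDensity_absolutelyContinuous {d : ℕ} (hd : 1 ≤ d) :
    (latticeDensity d).AbsolutelyContinuous MeasureTheory.volume := by
  obtain ⟨d, rfl⟩ : ∃ e, d = e + 1 := ⟨d - 1, by omega⟩
  refine MeasureTheory.Measure.AbsolutelyContinuous.mk fun s hs h0 => ?_
  have hmp := MeasureTheory.measurePreserving_piFinSuccAbove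
    (fun _ : Fin (d + 1) => unitMeasure) 0
  have hmT : Measurable fun y : ℝ × (Fin d → ℝ) => dispersion y.1 * ∏ k, dispersion (y.2 k) := by
    have := measurable_dispersion
    fun_prop
  have hpre : (fun x : Fin (d + 1) → ℝ => ∏ k, dispersion (x k)) ⁻¹' s =
      MeasurableEquiv.piFinSuccAbove (fun _ : Fin (d + 1) => ℝ) 0 ⁻¹'
        ((fun y : ℝ × (Fin d → ℝ) => dispersion y.1 * ∏ k, dispersion (y.2 k)) ⁻¹' s) := by
    ext x
    simp [Fin.prod_univ_succ, Fin.tail]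
  rw [latticeDensity, MeasureTheory.Measure.map_apply (measurable_prod_dispersion _) hs, hpre,
    hmp.measure_preimage (hmT hs).nullMeasurableSet,
    MeasureTheory.Measure.prod_apply_symm (hmT hs)]
  refine (MeasureTheory.lintegral_congr fun y => ?_).trans MeasureTheory.lintegral_zero
  have hp : ∏ k, dispersion (y k) ≠ 0 := Finset.prod_ne_zero_iff.2 fun k _ => dispersion_ne_zero _
  have h1 : MeasureTheory.volume ((· * ∏ k, dispersion (y k)) ⁻¹' s) = 0 := by
    rw [Real.volume_preimage_mul_right hp, h0, mul_zero]
  exact MeasureTheory.Measure.absolutelyContinuous_of_le MeasureTheory.Measure.restrict_le_self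
    (volume_preimage_dispersion h1)

/-- The measure is carried by the closed set `|t| ≥ (4 / 17) ^ d`, which therefore contains the
support, and `(4 / 17) ^ d` exceeds `1 / 5 ^ d` strictly. -/
theorem disjoint_support_latticeDensity {d : ℕ} (hd : 1 ≤ d) :
    Disjoint (latticeDensity d).support (Set.Icc (-(1 / 5 ^ d : ℝ)) (1 / 5 ^ d)) := by
  have hclosed : IsClosed {t : ℝ | (4 / 17) ^ d ≤ |t|} := isClosed_le (by fun_prop) (by fun_prop)
  have hsub : (latticeDensity d).support ⊆ {t : ℝ | (4 / 17) ^ d ≤ |t|} := by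
    refine MeasureTheory.Measure.support_subset_of_isClosed hclosed ?_
    rw [latticeDensity]
    refine (MeasureTheory.ae_map_iff (measurable_prod_dispersion d).aemeasurable
      hclosed.measurableSet).2 (Filter.Eventually.of_forall fun x => ?_)
    exact four_div_seventeen_pow_le_abs_prod_dispersion x
  refine Set.disjoint_left.2 fun t ht ht' => ?_
  have h1 := hsub ht
  have h2 := abs_le.2 ht'
  exact absurd (h1.trans h2) (not_le.2 (one_div_pow_lt hd))

theorem IsCyclicOrder.disjoint_spectrum {V : Type} [Finite V]
    {K : PreAbstractSimplicialComplex V} {N : ℕ} {u : ℤ → V} (h : IsCyclicOrder K N u)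
    (hN : 3 ≤ N) {d : ℕ} (hd : 1 ≤ d) :
    Disjoint (spectrum ℝ (connectionLaplacian K d))
      (Set.Icc (-(1 / 5 ^ d : ℝ)) (1 / 5 ^ d)) := by
  rw [(connectionLaplacian_isHermitian K d).spectrum_real_eq_range_eigenvalues]
  refine Set.disjoint_left.2 ?_
  rintro _ ⟨x, rfl⟩ ht
  have hface : ∀ s : K.faces, ∃ y : ℝ,
      dispersion y = (connectionMatrix_isHermitian K).eigenvalues s := by
    intro s
    have hs := Multiset.mem_map_of_mem (connectionMatrix_isHermitian K).eigenvalues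
      (Finset.mem_univ_val s)
    rw [h.map_eigenvalues_connectionMatrix hN] at hs
    obtain ⟨j, -, hj⟩ := Multiset.mem_map.1 hs
    exact ⟨_, hj⟩
  choose y hy using hface
  have hx := Multiset.mem_map_of_mem (connectionLaplacian_isHermitian K d).eigenvalues
    (Finset.mem_univ_val x)
  rw [eigenvalues_connectionLaplacian] at hx
  obtain ⟨z, -, hz⟩ := Multiset.mem_map.1 hx
  simp only [← hy] at hz
  have h1 := four_div_seventeen_pow_le_abs_prod_dispersion fun k => y (z k)
  rw [hz] at h1
  exact absurd (h1.trans (abs_le.2 ht)) (not_le.2 (one_div_pow_lt hd))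

end

/-! ### The mass gap theorem -/

theorem mainTheorem7 (d : ℕ) (hd : 1 ≤ d) :
    -- the spectra of the tori are multiplicative and have a uniform gap
    (∀ n : ℕ,
      densityOfStates (circularComplex (n + 3)) d =
          (MeasureTheory.Measure.pi
            (fun _ : Fin d => densityOfStates (circularComplex (n + 3)) 1)).map
            (fun t => ∏ k, t k) ∧
        Disjoint (spectrum ℝ (connectionLaplacian (circularComplex (n + 3)) d))
          (Set.Icc (-(1 / 5 ^ d : ℝ)) (1 / 5 ^ d))) ∧
    -- the densities of states have a weak limit, absolutely continuous and with a gap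
    (∃ κ : MeasureTheory.Measure ℝ, MeasureTheory.IsProbabilityMeasure κ ∧
      (∀ f : BoundedContinuousFunction ℝ ℝ,
        Filter.Tendsto (fun n : ℕ => ∫ t, f t ∂(densityOfStates (circularComplex (n + 3)) d))
          Filter.atTop (nhds (∫ t, f t ∂κ))) ∧
      (∀ (n : ℕ) (f : BoundedContinuousFunction ℝ ℝ),
        Filter.Tendsto
          (fun m : ℕ =>
            ∫ t, f t ∂(densityOfStates (iteratedRefinement (circularComplex (n + 3)) m) d))
          Filter.atTop (nhds (∫ t, f t ∂κ))) ∧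
      κ.AbsolutelyContinuous MeasureTheory.volume ∧
      Disjoint κ.support (Set.Icc (-(1 / 5 ^ d : ℝ)) (1 / 5 ^ d))) ∧
    -- the limiting operator, on the cells of the lattice, as limit of the tori `C_n^d` and of the
    -- Barycentric refinements of a torus (with the cells of each factor labelled cyclically)
    (∃ L : LatticeHilbert d →L[ℂ] LatticeHilbert d,
      (∀ i j : Fin d → ℤ,
        latticeEntry L i j =
          ((connectionLaplacian lineComplex d (orderedCell ℤ i) (orderedCell ℤ j) : ℝ) : ℂ)) ∧
      (∀ i j : Fin d → ℤ,
        Filter.Tendsto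
          (fun n : ℕ =>
            ((connectionLaplacian (circularComplex (n + 3)) d
              (orderedCell (ZMod (n + 3)) i) (orderedCell (ZMod (n + 3)) j) : ℝ) : ℂ))
          Filter.atTop (nhds (latticeEntry L i j))) ∧
      (∀ n : ℕ, ∃ e : ∀ m : ℕ, ℤ → (iteratedRefinement (circularComplex (n + 3)) m).faces,
        (∀ m : ℕ, Function.Surjective (e m) ∧
          ∀ a b : ℤ, e m a = e m b ↔
            (Nat.card (iteratedRefinement (circularComplex (n + 3)) m).faces : ℤ) ∣ a - b) ∧
        ∀ i j : Fin d → ℤ,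
          Filter.Tendsto
            (fun m : ℕ =>
              ((connectionLaplacian (iteratedRefinement (circularComplex (n + 3)) m) d
                (fun k => e m (i k)) (fun k => e m (j k)) : ℝ) : ℂ))
            Filter.atTop (nhds (latticeEntry L i j))) ∧
      IsSelfAdjoint L ∧
      IsDyadicAlmostPeriodic L ∧
      IsUnit L ∧
      ∀ t : ℝ, t ∈ Set.Icc (-(1 / 5 ^ d : ℝ)) (1 / 5 ^ d) → (t : ℂ) ∉ spectrum ℂ L) := by
  have hcirc : ∀ n : ℕ, IsCyclicOrder (circularComplex (n + 3)) (n + 3) Int.cast := fun n =>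
    isCyclicOrder_circularComplex (n + 3)
  have hcircN : Filter.Tendsto (fun n : ℕ => n + 3) Filter.atTop Filter.atTop :=
    Filter.tendsto_add_atTop_nat 3
  have href := fun n m => (hcirc n).exists_iteratedRefinement (by omega) m
  -- The `m`-th refinement is a cycle of length `(n + 3) * 2 ^ m`, so both limits are instances of
  -- the same statement about growing cycles.
  have hrefN : ∀ n : ℕ, Filter.Tendsto (fun m : ℕ => (n + 3) * 2 ^ m) Filter.atTop
      Filter.atTop := fun n =>
    Filter.Tendsto.const_mul_atTop' (by omega) (tendsto_pow_atTop_atTop_of_one_lt (by norm_num))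
  have hrefN3 : ∀ n m : ℕ, 3 ≤ (n + 3) * 2 ^ m := fun n m =>
    (by omega : 3 ≤ n + 3).trans (Nat.le_mul_of_pos_right _ (by positivity))
  choose u hu using href
  refine ⟨fun n => ⟨?_, (hcirc n).disjoint_spectrum (by omega) hd⟩,
    ⟨latticeDensity d, inferInstance, ?_, ?_, latticeDensity_absolutelyContinuous hd,
      disjoint_support_latticeDensity hd⟩, ?_⟩
  · rw [densityOfStates_one]
    exact densityOfStates_eq_map_pi _ ⟨(hcirc n).face 0⟩
  · exact tendsto_integral_densityOfStates hcirc (fun n => by omega) hcircN d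
  · exact fun n => tendsto_integral_densityOfStates (hu n) (hrefN3 n) (hrefN n) d
  · obtain ⟨L, hL, hsa, hap, hunit, hgap⟩ := exists_latticeLaplacian d hd
    refine ⟨L, fun i j => ?_, fun i j => ?_, fun n => ?_, hsa, hap, hunit, hgap⟩
    · rw [hL, connectionLaplacian_apply]
      congr 1
      exact Finset.prod_congr rfl fun k _ =>
        (isCyclicOrder_lineComplex.connectionMatrix_face_eq_lineKernel _ _ (Or.inl rfl)).symm
    · rw [hL]
      exact tendsto_connectionLaplacian_face hcirc hcircN i j
    · refine ⟨fun m => (hu n m).face, fun m => ⟨(hu n m).face_surjective, fun a b => ?_⟩,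
        fun i j => ?_⟩
      · have h3 := hrefN3 n m
        rw [(hu n m).natCard_faces h3]
        exact (hu n m).face_eq_iff (by omega) (by omega) a b
      · rw [hL]
        exact tendsto_connectionLaplacian_face (hu n) (hrefN n) i j
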